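/- **Proposition (modified Ward identity).** *Model.* Let $N\ge 1$, let $\lambda_1,\dots,\lambda_N$ and $\mu_1,\dots,\mu_N$ be real numbers (the eigenvalues of the disorder matrices $J$, $K$), $\sigma\in\mathbb R$, and put $p_1=\lambda_i+2\sigma$, $p_2=\mu_j+2\sigma$, $m=a_1-4\sigma$. Let $R_k(p_1,p_2)$ be any real-valued regulator, and let $$E_k(p_1,p_2)=p_1+p_2+m+R_k(p_1,p_2),\qquad \delta E_k(p_1,p_1',p_2)=E_k(p_1',p_2)-E_k(p_1,p_2).$$ Let $U(M)=\sum_{p=2}^{P}\frac{a_pN^{1-p}}{(p!)^2}\operatorname{Tr}(M^\dagger M)^p$ with real $a_p$, $P\ge2$, $a_P\neq0$. Fields are complex $N\times N$ matrices $M(t),\chi(t)$ with entries indexed by $\vec p=(p_1,p_2)$. The path integral is defined by its Itô time discretization: time is a periodic lattice $t\in\epsilon\,\mathbb Z/n\epsilon\,\mathbb Z$ ($\epsilon>0$, $n\ge1$), $\int dt=\epsilon\sum_t$, $\dot M(t)=(M(t+\epsilon)-M(t))/\epsilon$, the dual frequencies are $\omega_l=l\,\Delta\omega$, $\Delta\omega=2\pi/(n\epsilon)$,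 $-n/2<l\le n/2$, $\int d\omega=\Delta\omega\sum_l$, $f(\omega)=(2\pi)^{-1/2}\int dt\,f(t)e^{i\omega t}$, and $\delta/\delta J(\omega_l)=(\Delta\omega)^{-1}\partial/\partial J(\omega_l)$. With $(E_kM)_{\vec p}=E_k(\vec p)M_{\vec p}$ and temperature $1$, let $$S_k=\int dt\,\operatorname{Tr}\big[\chi^\dagger\chi+i\chi^\dagger(\dot M+E_kM+\partial_{\bar M}U)+i(\dot M+E_kM+\partial_{\bar M}U)^\dagger\chi\big],$$ $$Z_k(L,\bar L,\tilde L,\bar{\tilde L})=\int dM\,d\bar M\int d\chi\,d\bar\chi\;\exp\Big(-S_k+\int d\omega\sum_{\vec p}\big(\bar L M+\bar M L+\bar{\tilde L}\chi+\bar\chi\tilde L\big)\Big),$$ where $\chi$ is integrated first and $L,\bar L,\tilde L,\bar{\tilde L}$ are independent complex source fields in frequency space. A free energy $W_k$ is a continuous function on an open set of sources with $e^{W_k}=Z_k$ there. Put $$\Phi=\frac{\delta W_k}{\delta\bar L},\quad\bar\Phi=\frac{\delta W_k}{\delta L},\quad\eta=\frac{\delta W_k}{\delta\bar{\tilde L}},\quad\bar\eta=\frac{\delta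 W_k}{\delta\tilde L},$$ $$G_{k,\bar\eta\Phi}(\vec p\,',\omega';\vec p,\omega)=\frac{\delta^2W_k}{\delta\tilde L_{\vec p}(\omega)\,\delta\bar L_{\vec p\,'}(\omega')},\qquad G_{k,\bar\Phi\eta}(\vec p,\omega;\vec p\,',\omega')=\frac{\delta^2W_k}{\delta\bar{\tilde L}_{\vec p\,'}(\omega')\,\delta L_{\vec p}(\omega)}.$$ *Claim.* (1) For every $n\ge1$ and $\epsilon>0$, both iterated integrals defining $Z_k$ converge absolutely for all sources, $Z_k\neq0$ at zero sources, and every free energy $W_k$ is twice continuously differentiable. For any two values $p_1,p_1'$ of the first momentum, with $\vec p=(p_1,p_2)$ and $\vec p\,'=(p_1',p_2)$, at every source configuration where $W_k$ is defined, $$\int d\omega\sum_{p_2}\Big[i\,\delta E_k(p_1,p_1',p_2)\Big(G_{k,\bar\eta\Phi}(\vec p\,',\omega;\vec p,\omega)+\bar\eta_{\vec p}\Phi_{\vec p\,'}+G_{k,\bar\Phi\eta}(\vec p,\omega;\vec p\,',\omega)+\eta_{\vec p\,'}\bar\Phi_{\vec p}\Big)+\bar L_{\vec p}\Phi_{\vec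 p\,'}-L_{\vec p\,'}\bar\Phi_{\vec p}+\bar{\tilde L}_{\vec p}\,\eta_{\vec p\,'}-\tilde L_{\vec p\,'}\bar\eta_{\vec p}\Big]=0,\qquad(*)$$ all sources and fields being taken at frequency $\omega$. (2) The same identity $(*)$, with $\int d\omega$ the integral over $\mathbb R$ of an integrable function, holds for the continuum correlation functions, that is, for every limit of lattice theories along a sequence $\epsilon\to0$, $n\epsilon\to\infty$ in which (as step functions of $\omega$) the sources and the classical fields $\Phi,\bar\Phi,\eta,\bar\eta$ converge in $L^2(d\omega)$ and, whenever $p_1,p_1'$ belong to different eigenvalue labels, the equal-frequency functions $G_{k,\bar\eta\Phi}$, $G_{k,\bar\Phi\eta}$ converge in $L^1(d\omega)$ (for equal labels their coefficient $\delta E_k$ is $0$). -/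

import Mathlib

open MeasureTheory Filter Topology ComplexConjugate

/-- Bare data of the model with `N × N` complex matrices: the eigenvalues `lam` of `J` and `mu` of
`K` (sampled disorder, diagonalized), the Wigner edge parameter `sigma`, the couplings
`a 1, …, a deg` of the polynomial potential, and a momentum-space regulator
`R k p₁ p₂` (arbitrary real-valued function). -/
structure MSRModel (N : ℕ) where
  lam : Fin N → ℝ
  mu : Fin N → ℝ
  sigma : ℝ
  deg : ℕ
  a : ℕ → ℝ
  R : ℝ → ℝ → ℝ → ℝ

/-- The four independent source fields `L`, `L̄`, `L̃` and the conjugate of `L̃`. -/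
inductive SourceKind
  | L
  | Lbar
  | Lt
  | Ltbar
  deriving DecidableEq

instance : Fintype SourceKind where
  elems := {.L, .Lbar, .Lt, .Ltbar}
  complete := by intro x; cases x <;> simp

/-- Matrix-valued fields on a periodic time lattice with `n` sites. -/
abbrev LatticeField (n N : ℕ) : Type := ZMod n × Fin N × Fin N → ℂ

/-- Source configurations in frequency space: `J (κ, l, i, j)` is the value of the source of kind
`κ` with matrix indices `(i, j)` at the `l`-th lattice frequency. -/
abbrev LatticeSource (n N : ℕ) : Type := SourceKind × ZMod n × Fin N × Fin N → ℂ

noncomputable section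

namespace MSRModel

variable {N : ℕ}

/-- First momentum `p₁ = λ + 2σ`. -/
def p1 (S : MSRModel N) (i : Fin N) : ℝ := S.lam i + 2 * S.sigma

/-- Second momentum `p₂ = μ + 2σ`. -/
def p2 (S : MSRModel N) (j : Fin N) : ℝ := S.mu j + 2 * S.sigma

/-- The mass `m = a₁ - 4σ`. -/
def mass (S : MSRModel N) : ℝ := S.a 1 - 4 * S.sigma

/-- Regularized energy `E_k(p₁, p₂) = p₁ + p₂ + m + R_k(p₁, p₂)`. -/
def energy (S : MSRModel N) (k : ℝ) (i j : Fin N) : ℝ :=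
  S.p1 i + S.p2 j + S.mass + S.R k (S.p1 i) (S.p2 j)

/-- `δE_k(p₁, p₁', p₂) = E_k(p₁', p₂) - E_k(p₁, p₂)`. -/
def deltaE (S : MSRModel N) (k : ℝ) (i i' j : Fin N) : ℝ :=
  S.energy k i' j - S.energy k i j

/-- The `U(N) × U(N)`-invariant interaction
`U(M) = ∑_{p = 2}^{deg} a_p N^{1-p} / (p!)² Tr (M† M)^p`
(the term `p = 1` is part of the mass). -/
def potential (S : MSRModel N) (M : Matrix (Fin N) (Fin N) ℂ) : ℝ :=
  ∑ p ∈ Finset.Icc 2 S.deg,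
    S.a p * ((N : ℝ) ^ (p - 1))⁻¹ / (p.factorial : ℝ) ^ 2 * (((M.conjTranspose * M) ^ p).trace).re

/-- The Wirtinger gradient `∂U/∂M̄`; see `hasDerivAt_potential`. -/
def force (S : MSRModel N) (M : Matrix (Fin N) (Fin N) ℂ) : Matrix (Fin N) (Fin N) ℂ :=
  ∑ p ∈ Finset.Icc 2 S.deg,
    ((p * (S.a p * ((N : ℝ) ^ (p - 1))⁻¹ / (p.factorial : ℝ) ^ 2) : ℝ) : ℂ) •
      (M * (M.conjTranspose * M) ^ (p - 1))

section gradient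

theorem hasDerivAt_pow_line {A : Type*} [NormedRing A] [NormedAlgebra ℝ A] (T : A →L[ℝ] ℝ)
    (U V M X : A) (p : ℕ) :
    HasDerivAt (fun s : ℝ => T (((U + s • V) * (M + s • X)) ^ p))
      (∑ r ∈ Finset.range p, T ((U * M) ^ r * (V * M + U * X) * (U * M) ^ (p - 1 - r))) 0 := by
  have hlin : ∀ Y Z : A, HasDerivAt (fun s : ℝ => Y + s • Z) Z 0 := fun Y Z => by
    have := ((hasDerivAt_id (0 : ℝ)).smul_const Z).const_add Y
    rw [one_smul] at this
    exact this
  have hB : HasDerivAt (fun s : ℝ => (U + s • V) * (M + s • X)) (V * M + U * X) 0 := by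
    have h0 := (hlin U V).mul (hlin M X)
    simp only [zero_smul, add_zero] at h0
    exact h0
  have hpow : HasDerivAt (fun s : ℝ => ((U + s • V) * (M + s • X)) ^ p)
      (∑ r ∈ Finset.range p, (U * M) ^ r * (V * M + U * X) * (U * M) ^ (p - 1 - r)) 0 := by
    induction p with
    | zero => simpa using hasDerivAt_const (0 : ℝ) (1 : A)
    | succ p ih =>
      have h2 := ih.mul hB
      have e : (fun s : ℝ => ((U + s • V) * (M + s • X)) ^ (p + 1))
          = (fun s : ℝ => ((U + s • V) * (M + s • X)) ^ p) *
            fun s : ℝ => (U + s • V) * (M + s • X) := by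
        funext s; simp [pow_succ]
      rw [e]
      convert h2 using 1
      rw [Finset.sum_range_succ, Finset.sum_mul]
      congr 1
      · refine Finset.sum_congr rfl fun r hr => ?_
        have hr' := Finset.mem_range.1 hr
        have : p + 1 - 1 - r = (p - 1 - r) + 1 := by omega
        rw [this, pow_succ]
        simp [mul_assoc]
      · simp
  have h := (T.hasFDerivAt).comp_hasDerivAt (0 : ℝ) hpow
  rw [map_sum] at h
  exact h

theorem hasDerivAt_trace_pow (M X : Matrix (Fin N) (Fin N) ℂ) (p : ℕ) :
    HasDerivAt (fun s : ℝ => ((((M + s • X).conjTranspose * (M + s • X)) ^ p).trace).re)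
      (2 * p * ((X.conjTranspose * (M * (M.conjTranspose * M) ^ (p - 1))).trace).re) 0 := by
  let _ : NormedRing (Matrix (Fin N) (Fin N) ℂ) := Matrix.linftyOpNormedRing
  let _ : NormedAlgebra ℝ (Matrix (Fin N) (Fin N) ℂ) := Matrix.linftyOpNormedAlgebra
  let T0 : Matrix (Fin N) (Fin N) ℂ →ₗ[ℝ] ℝ :=
    { toFun := fun B => B.trace.re
      map_add' := fun B C => by simp [Matrix.trace_add]
      map_smul' := fun c B => by
        change (Matrix.trace (c • B)).re = c * B.trace.re
        rw [Matrix.trace_smul, Complex.smul_re, smul_eq_mul] }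
  have _ : FiniteDimensional ℝ (Matrix (Fin N) (Fin N) ℂ) :=
    inferInstanceAs (FiniteDimensional ℝ (Fin N → Fin N → ℂ))
  let T : Matrix (Fin N) (Fin N) ℂ →L[ℝ] ℝ := LinearMap.toContinuousLinearMap T0
  have h := hasDerivAt_pow_line T M.conjTranspose X.conjTranspose M X p
  have hf : (fun s : ℝ => ((((M + s • X).conjTranspose * (M + s • X)) ^ p).trace).re)
      = fun s : ℝ => T (((M.conjTranspose + s • X.conjTranspose) * (M + s • X)) ^ p) := by
    funext s
    have e : (M + s • X).conjTranspose = M.conjTranspose + s • X.conjTranspose := by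
      ext i j; simp
    rw [e]
    rfl
  set B := M.conjTranspose * M with hBdef
  have hBh : B.conjTranspose = B := by simp [hBdef]
  have key : ∀ r ∈ Finset.range p,
      T (B ^ r * (X.conjTranspose * M + M.conjTranspose * X) * B ^ (p - 1 - r))
        = 2 * ((X.conjTranspose * (M * B ^ (p - 1))).trace).re := by
    intro r hr
    have hr' := Finset.mem_range.1 hr
    change ((B ^ r * (X.conjTranspose * M + M.conjTranspose * X) * B ^ (p - 1 - r)).trace).re = _
    rw [Matrix.trace_mul_comm, ← mul_assoc, ← pow_add,
      show p - 1 - r + r = p - 1 by omega, mul_add, Matrix.trace_add, Complex.add_re]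
    have e1 : (B ^ (p - 1) * (X.conjTranspose * M)).trace
        = (X.conjTranspose * (M * B ^ (p - 1))).trace := by
      rw [Matrix.trace_mul_comm, mul_assoc]
    have e2 : (B ^ (p - 1) * (M.conjTranspose * X)).trace
        = star ((X.conjTranspose * (M * B ^ (p - 1))).trace) := by
      rw [← Matrix.trace_conjTranspose]
      simp only [Matrix.conjTranspose_mul, Matrix.conjTranspose_pow, hBh,
        Matrix.conjTranspose_conjTranspose, mul_assoc]
    rw [e1, e2, Complex.star_def, Complex.conj_re]
    ring
  have hsum : ∑ r ∈ Finset.range p,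
      T (B ^ r * (X.conjTranspose * M + M.conjTranspose * X) * B ^ (p - 1 - r))
        = 2 * p * ((X.conjTranspose * (M * B ^ (p - 1))).trace).re := by
    rw [Finset.sum_congr rfl key, Finset.sum_const, Finset.card_range, nsmul_eq_mul]
    ring
  have h' := h.congr_deriv hsum
  rw [hf]
  exact h'

/-- `force` is the Wirtinger gradient of `potential` with respect to `M̄`:
`dU = 2 Re Tr (dM† ∂U/∂M̄)`. -/
theorem hasDerivAt_potential (S : MSRModel N) (M X : Matrix (Fin N) (Fin N) ℂ) :
    HasDerivAt (fun s : ℝ => S.potential (M + s • X))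
      (2 * ((X.conjTranspose * S.force M).trace).re) 0 := by
  unfold potential
  have hs := HasDerivAt.fun_sum (u := Finset.Icc 2 S.deg) fun p _ =>
    (hasDerivAt_trace_pow M X p).const_mul (S.a p * ((N : ℝ) ^ (p - 1))⁻¹ / (p.factorial : ℝ) ^ 2)
  refine hs.congr_deriv ?_
  simp only [force, Finset.mul_sum, Matrix.trace_sum, Matrix.mul_smul, Matrix.trace_smul,
    Complex.re_sum, smul_eq_mul, Complex.re_ofReal_mul]
  refine Finset.sum_congr rfl fun p _ => ?_
  ring

end gradient

/-- Itô-discretized Langevin operator `Ṁ + E_k M + ∂U/∂M̄` at time `t`, lattice spacing `ε`: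
forward difference, all other terms evaluated at the left end of the time step. -/
def langevin (S : MSRModel N) (k : ℝ) {n : ℕ} (ε : ℝ) (M : LatticeField n N)
    (t : ZMod n) (i j : Fin N) : ℂ :=
  (M (t + 1, i, j) - M (t, i, j)) / (ε : ℂ) + (S.energy k i j : ℂ) * M (t, i, j)
    + S.force (Matrix.of fun i' j' => M (t, i', j')) i j

/-- The MSR action (temperature `T = 1`) with regulator,
`∫ dt Tr [χ†χ + i χ† (Ṁ + E_k M + ∂U) + i (Ṁ + E_k M + ∂U)† χ]`, on the time lattice. -/
def action (S : MSRModel N) (k : ℝ) {n : ℕ} [NeZero n] (ε : ℝ) (M χ : LatticeField n N) : ℂ :=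
  (ε : ℂ) * ∑ t : ZMod n, ∑ i : Fin N, ∑ j : Fin N,
    (conj (χ (t, i, j)) * χ (t, i, j)
      + Complex.I * conj (χ (t, i, j)) * S.langevin k ε M t i j
      + Complex.I * conj (S.langevin k ε M t i j) * χ (t, i, j))

end MSRModel

/-- Spacing `Δω = 2π / (n ε)` of the frequencies dual to the periodic lattice. -/
def freqStep (n : ℕ) (ε : ℝ) : ℝ := 2 * Real.pi / (n * ε)

/-- The lattice frequency `ω_l = l Δω`, with `l` represented in `(-n/2, n/2]`. -/
def latticeFreq {n : ℕ} (ε : ℝ) (l : ZMod n) : ℝ := freqStep n ε * (l.valMinAbs : ℝ)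

/-- Lattice version of `f(ω) = (2π)^{-1/2} ∫ dt f(t) e^{iωt}`. -/
def fourierMode {n N : ℕ} [NeZero n] (ε : ℝ) (f : LatticeField n N) (l : ZMod n) (i j : Fin N) :
    ℂ :=
  (ε / Real.sqrt (2 * Real.pi) : ℝ) *
    ∑ t : ZMod n, Complex.exp (Complex.I * latticeFreq ε l * ((t.val : ℝ) * ε : ℝ)) * f (t, i, j)

/-- The source term `L̄ · M + M̄ · L + conj(L̃) · χ + χ̄ · L̃`, with the dot product written as an
integral (here a sum of weight `Δω`) over frequency. -/
def sourceTerm {n N : ℕ} [NeZero n] (ε : ℝ) (J : LatticeSource n N) (M χ : LatticeField n N) : ℂ :=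
  (freqStep n ε : ℂ) * ∑ l : ZMod n, ∑ i : Fin N, ∑ j : Fin N,
    (J (.Lbar, l, i, j) * fourierMode ε M l i j
      + conj (fourierMode ε M l i j) * J (.L, l, i, j)
      + J (.Ltbar, l, i, j) * fourierMode ε χ l i j
      + conj (fourierMode ε χ l i j) * J (.Lt, l, i, j))

/-- The functional derivative `δf/δJ_κ(ω_l)_{ij} = (Δω)⁻¹ ∂f/∂J_κ(ω_l)_{ij}`. -/
def funcDeriv {n N : ℕ} [NeZero n] (ε : ℝ) (κ : SourceKind) (l : ZMod n) (i j : Fin N)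
    (f : LatticeSource n N → ℂ) (J : LatticeSource n N) : ℂ :=
  (freqStep n ε : ℂ)⁻¹ * fderiv ℂ f J (Pi.single (κ, l, i, j) 1)

namespace MSRModel

variable {N : ℕ}

/-- The weight `exp (-S + sources)` of the path integral. -/
def weight (S : MSRModel N) (k : ℝ) {n : ℕ} [NeZero n] (ε : ℝ) (J : LatticeSource n N)
    (M χ : LatticeField n N) : ℂ :=
  Complex.exp (-S.action k ε M χ + sourceTerm ε J M χ)

/-- The regularized MSR generating functional
`Z_k = ∫ dM dM̄ dχ dχ̄ exp (-S + sources)`; the response field, which comes from linearizing the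
square of the Langevin equation, is integrated first. -/
def partitionFunction (S : MSRModel N) (k : ℝ) {n : ℕ} [NeZero n] (ε : ℝ)
    (J : LatticeSource n N) : ℂ :=
  ∫ M : LatticeField n N, ∫ χ : LatticeField n N, S.weight k ε J M χ

/-- `W` is (a continuous branch of) the free energy `W_k = log Z_k` on the open set `O` of
source configurations. -/
def IsFreeEnergy (S : MSRModel N) (k : ℝ) {n : ℕ} [NeZero n] (ε : ℝ)
    (O : Set (LatticeSource n N)) (W : LatticeSource n N → ℂ) : Prop :=
  IsOpen O ∧ ContinuousOn W O ∧ ∀ J ∈ O, Complex.exp (W J) = S.partitionFunction k ε J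

end MSRModel

section correlations

variable {n N : ℕ} [NeZero n]

/-- `Φ = δW/δL̄`. -/
def fieldPhi (ε : ℝ) (W : LatticeSource n N → ℂ) (J : LatticeSource n N) (l : ZMod n)
    (i j : Fin N) : ℂ := funcDeriv ε .Lbar l i j W J

/-- `Φ̄ = δW/δL`. -/
def fieldPhiBar (ε : ℝ) (W : LatticeSource n N → ℂ) (J : LatticeSource n N) (l : ZMod n)
    (i j : Fin N) : ℂ := funcDeriv ε .L l i j W J

/-- `η = δW/δ(conj L̃)`. -/
def fieldEta (ε : ℝ) (W : LatticeSource n N → ℂ) (J : LatticeSource n N) (l : ZMod n)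
    (i j : Fin N) : ℂ := funcDeriv ε .Ltbar l i j W J

/-- `η̄ = δW/δL̃`. -/
def fieldEtaBar (ε : ℝ) (W : LatticeSource n N → ℂ) (J : LatticeSource n N) (l : ZMod n)
    (i j : Fin N) : ℂ := funcDeriv ε .Lt l i j W J

/-- `G_{η̄Φ}(p⃗', ω'; p⃗, ω) = δ²W / δL̃_p⃗(ω) δL̄_p⃗'(ω')`, with `p⃗' = (i', j')`, `p⃗ = (i, j)`. -/
def corrEtaBarPhi (ε : ℝ) (W : LatticeSource n N → ℂ) (J : LatticeSource n N)
    (l' : ZMod n) (i' j' : Fin N) (l : ZMod n) (i j : Fin N) : ℂ :=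
  funcDeriv ε .Lt l i j (funcDeriv ε .Lbar l' i' j' W) J

/-- `G_{Φ̄η}(p⃗, ω; p⃗', ω') = δ²W / δ(conj L̃)_p⃗'(ω') δL_p⃗(ω)`. -/
def corrPhiBarEta (ε : ℝ) (W : LatticeSource n N → ℂ) (J : LatticeSource n N)
    (l : ZMod n) (i j : Fin N) (l' : ZMod n) (i' j' : Fin N) : ℂ :=
  funcDeriv ε .Ltbar l' i' j' (funcDeriv ε .L l i j W) J

end correlations

/-- A function of the lattice frequency, viewed as a step function on the frequency line: the value
at `ω_l` is taken on the cell `[ω_l - Δω/2, ω_l + Δω/2)`, and `0` is taken outside the band. -/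
def stepFn {n : ℕ} (ε : ℝ) (f : ZMod n → ℂ) (ω : ℝ) : ℂ :=
  if (((round (ω / freqStep n ε) : ℤ) : ZMod n)).valMinAbs = round (ω / freqStep n ε) then
    f ((round (ω / freqStep n ε) : ℤ) : ZMod n)
  else 0

/-- Lattice functions of frequency converge in `L^r(dω)` to a function on the frequency line. -/
def FreqTendsto (r : ENNReal) (n : ℕ → ℕ) (ε : ℕ → ℝ) (f : ∀ s, ZMod (n s) → ℂ) (g : ℝ → ℂ) :
    Prop :=
  MemLp g r volume ∧
    Tendsto (fun s => eLpNorm (fun ω => stepFn (ε s) (f s) ω - g ω) r volume) atTop (𝓝 0)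

/-- Sources, classical fields and equal-frequency two-point functions on the frequency line.
`GEtaBarPhi i' i j ω` stands for `G_{η̄Φ}(p⃗', ω; p⃗, ω)` and `GPhiBarEta i i' j ω` for
`G_{Φ̄η}(p⃗, ω; p⃗', ω)`, where `p⃗ = (i, j)`, `p⃗' = (i', j)`. -/
structure ContinuumData (N : ℕ) where
  L : Fin N → Fin N → ℝ → ℂ
  Lbar : Fin N → Fin N → ℝ → ℂ
  Lt : Fin N → Fin N → ℝ → ℂ
  Ltbar : Fin N → Fin N → ℝ → ℂ
  Phi : Fin N → Fin N → ℝ → ℂ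
  PhiBar : Fin N → Fin N → ℝ → ℂ
  Eta : Fin N → Fin N → ℝ → ℂ
  EtaBar : Fin N → Fin N → ℝ → ℂ
  GEtaBarPhi : Fin N → Fin N → Fin N → ℝ → ℂ
  GPhiBarEta : Fin N → Fin N → Fin N → ℝ → ℂ

/-- `D` is the continuum limit (spacing to `0`, period to `∞`) of the lattice theories with free
energies `W s` in the presence of the sources `J s`: sources and classical fields converge in
`L²(dω)`, equal-frequency two-point functions converge in `L¹(dω)`. The latter is asked only for
`i ≠ i'`: for `i = i'` conservation of frequency makes them proportional to `δ(0)`. -/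
structure IsContinuumLimit {N : ℕ} (n : ℕ → ℕ) [∀ s, NeZero (n s)] (ε : ℕ → ℝ)
    (W : ∀ s, LatticeSource (n s) N → ℂ) (J : ∀ s, LatticeSource (n s) N)
    (D : ContinuumData N) : Prop where
  spacing : Tendsto ε atTop (𝓝 0)
  period : Tendsto (fun s => (n s : ℝ) * ε s) atTop atTop
  L : ∀ i j, FreqTendsto 2 n ε (fun s l => J s (.L, l, i, j)) (D.L i j)
  Lbar : ∀ i j, FreqTendsto 2 n ε (fun s l => J s (.Lbar, l, i, j)) (D.Lbar i j)
  Lt : ∀ i j, FreqTendsto 2 n ε (fun s l => J s (.Lt, l, i, j)) (D.Lt i j)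
  Ltbar : ∀ i j, FreqTendsto 2 n ε (fun s l => J s (.Ltbar, l, i, j)) (D.Ltbar i j)
  Phi : ∀ i j, FreqTendsto 2 n ε (fun s l => fieldPhi (ε s) (W s) (J s) l i j) (D.Phi i j)
  PhiBar : ∀ i j,
    FreqTendsto 2 n ε (fun s l => fieldPhiBar (ε s) (W s) (J s) l i j) (D.PhiBar i j)
  Eta : ∀ i j, FreqTendsto 2 n ε (fun s l => fieldEta (ε s) (W s) (J s) l i j) (D.Eta i j)
  EtaBar : ∀ i j,
    FreqTendsto 2 n ε (fun s l => fieldEtaBar (ε s) (W s) (J s) l i j) (D.EtaBar i j)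
  GEtaBarPhi : ∀ i i' j, i ≠ i' →
    FreqTendsto 1 n ε (fun s l => corrEtaBarPhi (ε s) (W s) (J s) l i' j l i j)
      (D.GEtaBarPhi i' i j)
  GPhiBarEta : ∀ i i' j, i ≠ i' →
    FreqTendsto 1 n ε (fun s l => corrPhiBarEta (ε s) (W s) (J s) l i j l i' j)
      (D.GPhiBarEta i i' j)

end

/-! The response field enters the action quadratically, so for fixed `M` its integral is an explicit
Gaussian. What remains is the weight `exp(-∫ Tr A†A)`, with `A` the Langevin operator, and a source
term in which `χ` has become `-iA`, times a constant and a contact factor `exp ∫ L̃ · conj L̃`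
(`integral_weight`).

Convergence does not depend on the signs of the couplings. The force is `F = M q(M†M)` with `q` a
nonconstant polynomial, and `Tr F†F = ∑ x q(x)²` over the eigenvalues `x ≥ 0` of `M†M`, so `F` grows
faster than linearly. At fixed lattice spacing it therefore dominates both the difference quotient
and the energy term (`exists_mul_norm_le_langevinField`). The weight then has exponential moments of
every order, `Z` is a smooth function of the sources, and a continuous `W` with `exp W = Z` is
locally a smooth logarithm.

The identity comes from the substitution `M ↦ VM` with `V` unitary and constant in time. Lebesgue
measure is invariant and the time difference and the force are equivariant; only the energy and the
sources break the symmetry. Differentiating along `V = exp(sX)` shows that the variation of the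
exponent has integral zero for anti-Hermitian `X` (`integral_exponentVar_of_skew`). Written with
independent variations of `M` and `M̄`, this variation is complex-linear in `X`, so the statement
extends to all `X`, in particular to a matrix unit (`integral_exponentVar`). For a matrix unit it is
the integrand of the Ward identity (`exponentVar_single`), and derivatives of the logarithm turn
mean values into two-point functions and classical fields. The contact factor shifts `η̄` and `η` by
`conj L̃` and `L̃`; these shifts absorb exactly the terms in which the energy breaking acts on the
sources of `χ`.

In the continuum limit the lattice sums are integrals of step functions; products of `L²`-convergent
factors converge in `L¹`, so the vanishing integrals pass to the limit. -/

noncomputable section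

/-! ### Superlinear growth of the force and of the Langevin operator. -/

theorem exists_mul_le_mul_eval_sq (q : Polynomial ℝ) (hq : 0 < q.degree) (K : ℝ) :
    ∃ C, 0 ≤ C ∧ ∀ x, 0 ≤ x → K * x ≤ x * q.eval x ^ 2 + C := by
  have h1 : Tendsto (fun x => |q.eval x|) atTop atTop := q.abs_tendsto_atTop hq
  obtain ⟨x0, hx0⟩ := (h1.eventually_ge_atTop (|K| + 1)).exists_forall_of_atTop
  -- Beyond `x0` one has `|q| ≥ |K| + 1`, hence `q² ≥ K`; below `x0` the left side is at most `|K|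
  -- |x0|`.
  refine ⟨|K| * |x0|, by positivity, fun x hx => ?_⟩
  rcases le_total x0 x with h | h
  · have h2 := hx0 x h
    have h3 : K ≤ q.eval x ^ 2 := by
      rw [← sq_abs]
      nlinarith [le_abs_self K, abs_nonneg K]
    have : 0 ≤ |K| * |x0| := by positivity
    nlinarith
  · have h2 : K * x ≤ |K| * |x0| :=
      (mul_le_mul_of_nonneg_right (le_abs_self K) hx).trans
        (mul_le_mul_of_nonneg_left (h.trans (le_abs_self _)) (abs_nonneg K))
    have : 0 ≤ x * q.eval x ^ 2 := by positivity
    linarith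

theorem trace_conjTranspose_mul_self_re {N : ℕ} (M : Matrix (Fin N) (Fin N) ℂ) :
    ((M.conjTranspose * M).trace).re = ∑ i, ∑ j, ‖M i j‖ ^ 2 := by
  rw [Finset.sum_comm]
  simp only [Matrix.trace, Matrix.diag, Matrix.mul_apply, Matrix.conjTranspose_apply,
    Complex.re_sum]
  refine Finset.sum_congr rfl fun i _ => Finset.sum_congr rfl fun j _ => ?_
  rw [Complex.star_def, ← Complex.normSq_eq_conj_mul_self, Complex.ofReal_re, Complex.sq_norm]

open Polynomial in
-- Diagonalization by a unitary reduces each power to a diagonal matrix, and the trace ignores the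
-- conjugation; linearity does the rest.
theorem Matrix.IsHermitian.trace_aeval {N : ℕ} {B : Matrix (Fin N) (Fin N) ℂ}
    (hB : B.IsHermitian) (r : ℝ[X]) :
    (aeval B r).trace = ∑ i, ((r.eval (hB.eigenvalues i) : ℝ) : ℂ) := by
  have key : ∀ k : ℕ, (B ^ k).trace = ∑ i, ((hB.eigenvalues i ^ k : ℝ) : ℂ) := by
    intro k
    conv_lhs => rw [hB.spectral_theorem]
    rw [← map_pow, Matrix.diagonal_pow, Unitary.conjStarAlgAut_apply, Matrix.trace_mul_comm,
      ← mul_assoc]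
    simp [Matrix.trace]
  induction r using Polynomial.induction_on' with
  | add p q hp hq => simp [hp, hq, Matrix.trace_add, Finset.sum_add_distrib]
  | monomial k a =>
    rw [aeval_monomial, Matrix.trace, ← Matrix.trace]
    rw [← Algebra.smul_def, Matrix.trace_smul, key]
    simp [Finset.smul_sum]

namespace MSRModel
variable {N : ℕ}

open Polynomial in
/-- The polynomial `q` with `∂U/∂M̄ = M q(M† M)`. -/
def forcePoly (S : MSRModel N) : ℝ[X] :=
  ∑ p ∈ Finset.Icc 2 S.deg,
    monomial (p - 1) (p * (S.a p * ((N : ℝ) ^ (p - 1))⁻¹ / (p.factorial : ℝ) ^ 2))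

/-- This form serves twice: it makes `F†F` a polynomial in `M†M`, and it makes the equivariance
under left unitary multiplication evident. -/
theorem force_eq (S : MSRModel N) (M : Matrix (Fin N) (Fin N) ℂ) :
    S.force M = M * Polynomial.aeval (M.conjTranspose * M) S.forcePoly := by
  simp only [force, forcePoly, map_sum, Polynomial.aeval_monomial, Finset.mul_sum]
  refine Finset.sum_congr rfl fun p _ => ?_
  rw [← Algebra.smul_def, mul_smul_comm]
  ext i j
  simp only [Matrix.smul_apply, Complex.real_smul, smul_eq_mul]

/-- Different `p` contribute different powers `p - 1`, so the leading term cannot cancel. Only `a_P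
≠ 0` and `P ≥ 2` matter, not the sign of `a_P`. -/
theorem degree_forcePoly_pos [NeZero N] (S : MSRModel N) (hdeg : 2 ≤ S.deg)
    (ha : S.a S.deg ≠ 0) : 0 < S.forcePoly.degree := by
  have hc : S.forcePoly.coeff (S.deg - 1) ≠ 0 := by
    unfold forcePoly
    simp only [Polynomial.finsetSum_coeff, Polynomial.coeff_monomial]
    rw [Finset.sum_eq_single S.deg]
    · have : (N : ℝ) ≠ 0 := Nat.cast_ne_zero.2 (NeZero.ne N)
      have h2 : (S.deg : ℝ) ≠ 0 := Nat.cast_ne_zero.2 (by omega)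
      have h3 : (S.deg.factorial : ℝ) ≠ 0 := Nat.cast_ne_zero.2 (Nat.factorial_ne_zero _)
      simp [ha, this, h2, h3]
    · intro b hb hne
      rw [Finset.mem_Icc] at hb
      rw [if_neg (by omega)]
    · intro h
      exact absurd (Finset.mem_Icc.2 ⟨hdeg, le_rfl⟩) h
  have h1 := Polynomial.le_degree_of_ne_zero hc
  refine lt_of_lt_of_le ?_ h1
  exact_mod_cast (by omega : 0 < S.deg - 1)

open scoped ComplexOrder in
-- With `B = M†M` one has `F†F = B q(B)²`, so both sides are sums over the eigenvalues of `B`, which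
-- are nonnegative, and the scalar inequality applies to each of them. The `N` eigenvalues account
-- for the constant `N * C`.
theorem exists_mul_sum_le_force [NeZero N] (S : MSRModel N) (hdeg : 2 ≤ S.deg)
    (ha : S.a S.deg ≠ 0) (K : ℝ) :
    ∃ C, 0 ≤ C ∧ ∀ M : Matrix (Fin N) (Fin N) ℂ,
      K * ∑ i, ∑ j, ‖M i j‖ ^ 2 ≤ (∑ i, ∑ j, ‖S.force M i j‖ ^ 2) + C := by
  obtain ⟨C, hC, h⟩ := exists_mul_le_mul_eval_sq S.forcePoly (S.degree_forcePoly_pos hdeg ha) K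
  refine ⟨N * C, by positivity, fun M => ?_⟩
  set B := M.conjTranspose * M with hBdef
  have hB : B.IsHermitian := Matrix.isHermitian_conjTranspose_mul_self M
  have hpos : ∀ i, 0 ≤ hB.eigenvalues i :=
    (Matrix.posSemidef_conjTranspose_mul_self M).eigenvalues_nonneg
  have hQ : (Polynomial.aeval B S.forcePoly).conjTranspose = Polynomial.aeval B S.forcePoly := by
    rw [Polynomial.aeval_eq_sum_range]
    simp only [Matrix.conjTranspose_sum]
    refine Finset.sum_congr rfl fun k _ => ?_
    rw [Matrix.conjTranspose_smul, Matrix.conjTranspose_pow, hB.eq]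
    simp
  have e1 : (S.force M).conjTranspose * S.force M
      = Polynomial.aeval B (Polynomial.X * S.forcePoly ^ 2) := by
    have hc : Polynomial.aeval B S.forcePoly * B = B * Polynomial.aeval B S.forcePoly := by
      have := congrArg (Polynomial.aeval B) (mul_comm S.forcePoly Polynomial.X)
      simpa only [map_mul, Polynomial.aeval_X] using this
    rw [force_eq, ← hBdef, Matrix.conjTranspose_mul, hQ, mul_assoc,
      ← mul_assoc M.conjTranspose, ← hBdef, ← mul_assoc, hc]
    simp only [map_mul, Polynomial.aeval_X, pow_two, mul_assoc]
  rw [← trace_conjTranspose_mul_self_re, ← trace_conjTranspose_mul_self_re, e1, ← hBdef,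
    hB.trace_aeval, hB.trace_eq_sum_eigenvalues]
  simp only [Complex.re_sum, Complex.ofReal_re, Complex.coe_algebraMap, Polynomial.eval_mul,
    Polynomial.eval_X, Polynomial.eval_pow]
  rw [Finset.mul_sum]
  calc ∑ i, K * hB.eigenvalues i
      ≤ ∑ i, (hB.eigenvalues i * S.forcePoly.eval (hB.eigenvalues i) ^ 2 + C) :=
        Finset.sum_le_sum fun i _ => h _ (hpos i)
    _ = _ := by simp [Finset.sum_add_distrib]

/-- The Langevin operator as a map on lattice fields. -/
def langevinField (S : MSRModel N) (k : ℝ) {n : ℕ} (ε : ℝ) (M : LatticeField n N) :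
    LatticeField n N :=
  fun p => S.langevin k ε M p.1 p.2.1 p.2.2

/-- The difference quotient and the energy term are at most linear in the sup norm of `M`, while the
force at the site where `|M|` is largest beats any linear function of that norm. -/
theorem exists_mul_norm_le_langevinField [NeZero N] (S : MSRModel N) (hdeg : 2 ≤ S.deg)
    (ha : S.a S.deg ≠ 0) (k : ℝ) {n : ℕ} [NeZero n] {ε : ℝ} (hε : 0 < ε) (K : ℝ) :
    ∃ C, ∀ M : LatticeField n N, K * ‖M‖ ≤ ‖S.langevinField k ε M‖ + C := by
  have hN : 0 < (N : ℝ) := Nat.cast_pos.2 (NeZero.pos N)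
  set E := ∑ i, ∑ j, |S.energy k i j| with hE
  have hE0 : 0 ≤ E := by positivity
  have hEle : ∀ i j, |S.energy k i j| ≤ E := fun i j =>
    (Finset.single_le_sum (f := fun j => |S.energy k i j|) (fun _ _ => abs_nonneg _)
      (Finset.mem_univ j)).trans
    (Finset.single_le_sum (f := fun i => ∑ j, |S.energy k i j|)
      (fun _ _ => Finset.sum_nonneg fun _ _ => abs_nonneg _) (Finset.mem_univ i))
  -- `2 / ε + E` pays for the difference quotient and the energy, `|K|` is what must be left over,
  -- and `N` comes from bounding the `N²` squared entries of the force by their maximum.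
  set K' := N * (|K| + 2 / ε + E) with hK'
  have hK'0 : 0 ≤ K' := by positivity
  obtain ⟨C, hC, h⟩ := S.exists_mul_sum_le_force hdeg ha (K' ^ 2)
  refine ⟨Real.sqrt C / N, fun M => ?_⟩
  obtain ⟨p, -, hp⟩ := Finset.exists_max_image Finset.univ (fun p => ‖M p‖)
    (Finset.univ_nonempty (α := ZMod n × Fin N × Fin N))
  have hMp : ‖M‖ = ‖M p‖ :=
    le_antisymm ((pi_norm_le_iff_of_nonneg (norm_nonneg _)).2 fun q => hp q (Finset.mem_univ q))
      (norm_le_pi_norm M p)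
  set a := ‖S.langevinField k ε M‖ with ha'
  set f := a + (2 / ε + E) * ‖M‖ with hf
  have hf0 : 0 ≤ f := by positivity
  obtain ⟨t, i, j⟩ := p
  have hF : ∀ i j, ‖S.force (Matrix.of fun i' j' => M (t, i', j')) i j‖ ≤ f := by
    intro i j
    have h1 : S.force (Matrix.of fun i' j' => M (t, i', j')) i j
        = S.langevinField k ε M (t, i, j) - (M (t + 1, i, j) - M (t, i, j)) / (ε : ℂ)
          - (S.energy k i j : ℂ) * M (t, i, j) := by
      simp only [langevinField, langevin]; ring
    rw [h1]
    have h2 := norm_le_pi_norm (S.langevinField k ε M) (t, i, j)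
    have h3 : ‖(M (t + 1, i, j) - M (t, i, j)) / (ε : ℂ)‖ ≤ 2 / ε * ‖M‖ := by
      rw [norm_div, Complex.norm_real, Real.norm_of_nonneg hε.le, div_mul_eq_mul_div]
      gcongr
      have := norm_sub_le (M (t + 1, i, j)) (M (t, i, j))
      linarith [norm_le_pi_norm M (t + 1, i, j), norm_le_pi_norm M (t, i, j)]
    have h4 : ‖(S.energy k i j : ℂ) * M (t, i, j)‖ ≤ E * ‖M‖ := by
      rw [norm_mul, Complex.norm_real, Real.norm_eq_abs]
      exact mul_le_mul (hEle i j) (norm_le_pi_norm M _) (norm_nonneg _) hE0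
    refine (norm_sub_le _ _).trans ?_
    have := norm_sub_le (S.langevinField k ε M (t, i, j))
      ((M (t + 1, i, j) - M (t, i, j)) / (ε : ℂ))
    rw [hf]; linarith
  -- The cross term of the square on the right is nonnegative and is discarded; this lets the
  -- additive constant pass through the square root.
  have h5 : (K' * ‖M‖) ^ 2 ≤ (N * f + Real.sqrt C) ^ 2 := by
    have h6 := h (Matrix.of fun i' j' => M (t, i', j'))
    have h7 : ‖M‖ ^ 2 ≤ ∑ i, ∑ j, ‖(Matrix.of fun i' j' => M (t, i', j')) i j‖ ^ 2 := by
      rw [hMp]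
      refine le_trans ?_ (Finset.single_le_sum (f := fun i => ∑ j, ‖(Matrix.of fun i' j' =>
        M (t, i', j')) i j‖ ^ 2) (fun _ _ => by positivity) (Finset.mem_univ i))
      exact Finset.single_le_sum (f := fun j => ‖(Matrix.of fun i' j' =>
        M (t, i', j')) i j‖ ^ 2) (fun _ _ => by positivity) (Finset.mem_univ j)
    have h8 : ∑ i, ∑ j, ‖S.force (Matrix.of fun i' j' => M (t, i', j')) i j‖ ^ 2
        ≤ (N * f) ^ 2 := by
      calc _ ≤ ∑ i : Fin N, ∑ j : Fin N, f ^ 2 := by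
            gcongr with i _ j _
            exact hF i j
        _ = _ := by simp; ring
    have h9 := Real.sq_sqrt hC
    have : K' ^ 2 * ‖M‖ ^ 2 ≤ (N * f) ^ 2 + C := by
      refine (mul_le_mul_of_nonneg_left h7 (sq_nonneg K')).trans (h6.trans ?_)
      linarith
    have : 0 ≤ 2 * (N * f) * Real.sqrt C := by positivity
    nlinarith
  have h10 := abs_le_of_sq_le_sq' h5 (by positivity)
  have h11 := h10.2
  have h12 : |K| * ‖M‖ ≤ a + Real.sqrt C / N := by
    have : N * (|K| * ‖M‖) ≤ N * (a + Real.sqrt C / N) := by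
      have e : N * (a + Real.sqrt C / N) = N * a + Real.sqrt C := by field_simp
      rw [e]
      rw [hK', hf] at h11
      nlinarith
    exact le_of_mul_le_mul_left this hN
  exact (mul_le_mul_of_nonneg_right (le_abs_self K) (norm_nonneg _)).trans h12

end MSRModel

/-! ### Differentiation of Laplace transforms in the sources. -/

section laplace

variable {X E : Type*} [MeasurableSpace X] {μ : Measure X} [NormedAddCommGroup E]
  [NormedSpace ℂ E]

/-- The Laplace transform `J ↦ ∫ w(x) exp (ℓ(x) J) dμ(x)`. -/
def laplaceTransform (μ : Measure X) (ℓ : X → E →L[ℂ] ℂ) (w : X → ℂ) (J : E) : ℂ :=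
  ∫ x, w x * Complex.exp (ℓ x J) ∂μ

/-- Weights with all exponential moments with respect to `‖ℓ‖`. -/
def HasExpMoments (μ : Measure X) (ℓ : X → E →L[ℂ] ℂ) (w : X → ℂ) : Prop :=
  AEStronglyMeasurable w μ ∧ ∀ R : ℝ, Integrable (fun x => ‖w x‖ * Real.exp (R * ‖ℓ x‖)) μ

theorem norm_cexp_clm_le (ℓ : E →L[ℂ] ℂ) (J : E) :
    ‖Complex.exp (ℓ J)‖ ≤ Real.exp (‖J‖ * ‖ℓ‖) := by
  rw [Complex.norm_exp]
  refine Real.exp_le_exp.2 ((Complex.re_le_norm _).trans ?_)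
  rw [mul_comm]
  exact ℓ.le_opNorm J

variable {ℓ : X → E →L[ℂ] ℂ} {w : X → ℂ}

/-- A linear factor satisfies `|ℓ(v)| ≤ ‖v‖ exp ‖ℓ‖`, which only raises `R` by one. The class of
weights is thus stable under differentiation of the transform. -/
theorem HasExpMoments.mul_apply (h : HasExpMoments μ ℓ w) (hℓ : AEStronglyMeasurable ℓ μ) (v : E) :
    HasExpMoments μ ℓ (fun x => w x * ℓ x v) := by
  have hm : AEStronglyMeasurable (fun x => ℓ x v) μ :=
    (ContinuousLinearMap.apply ℂ ℂ v).continuous.comp_aestronglyMeasurable hℓ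
  refine ⟨h.1.mul hm, fun R => ?_⟩
  refine ((h.2 (R + 1)).mul_const ‖v‖).mono' ?_ (ae_of_all _ fun x => ?_)
  · exact (h.1.mul hm).norm.mul
      (Real.continuous_exp.comp_aestronglyMeasurable (hℓ.norm.const_mul R))
  · rw [Real.norm_of_nonneg (by positivity), norm_mul]
    have h1 := (ℓ x).le_opNorm v
    have h2 : ‖ℓ x‖ ≤ Real.exp ‖ℓ x‖ := by linarith [Real.add_one_le_exp ‖ℓ x‖]
    have h3 : Real.exp ((R + 1) * ‖ℓ x‖) = Real.exp (R * ‖ℓ x‖) * Real.exp ‖ℓ x‖ := by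
      rw [← Real.exp_add]; ring_nf
    rw [h3]
    calc ‖w x‖ * ‖ℓ x v‖ * Real.exp (R * ‖ℓ x‖)
        ≤ ‖w x‖ * (Real.exp ‖ℓ x‖ * ‖v‖) * Real.exp (R * ‖ℓ x‖) := by
          gcongr
          exact h1.trans (by gcongr)
      _ = _ := by ring

theorem HasExpMoments.integrable (h : HasExpMoments μ ℓ w) (hℓ : AEStronglyMeasurable ℓ μ)
    (J : E) : Integrable (fun x => w x * Complex.exp (ℓ x J)) μ := by
  have hm : AEStronglyMeasurable (fun x => ℓ x J) μ :=
    (ContinuousLinearMap.apply ℂ ℂ J).continuous.comp_aestronglyMeasurable hℓ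
  refine (h.2 ‖J‖).mono' (h.1.mul (Complex.continuous_exp.comp_aestronglyMeasurable hm))
    (ae_of_all _ fun x => ?_)
  rw [norm_mul]
  gcongr
  exact norm_cexp_clm_le _ _

theorem HasExpMoments.hasFDerivAt (h : HasExpMoments μ ℓ w) (hℓ : AEStronglyMeasurable ℓ μ)
    (J : E) : HasFDerivAt (laplaceTransform μ ℓ w)
      (∫ x, (w x * Complex.exp (ℓ x J)) • ℓ x ∂μ) J := by
  have hm : ∀ J, AEStronglyMeasurable (fun x => ℓ x J) μ := fun J =>
    (ContinuousLinearMap.apply ℂ ℂ J).continuous.comp_aestronglyMeasurable hℓ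
  have hw : ∀ J, AEStronglyMeasurable (fun x => w x * Complex.exp (ℓ x J)) μ := fun J =>
    h.1.mul (Complex.continuous_exp.comp_aestronglyMeasurable (hm J))
  refine hasFDerivAt_integral_of_dominated_of_fderiv_le (s := Metric.ball J 1)
    -- One unit in the exponent covers the radius of the ball around `J`, the other absorbs the
    -- factor `‖ℓ x‖` produced by the derivative.
    (bound := fun x => ‖w x‖ * Real.exp ((‖J‖ + 1 + 1) * ‖ℓ x‖))
    (F' := fun J x => (w x * Complex.exp (ℓ x J)) • ℓ x) (Metric.ball_mem_nhds J one_pos)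
    (Eventually.of_forall hw) (h.integrable hℓ J) ((hw J).smul hℓ)
    (ae_of_all _ fun x J' hJ' => ?_) (h.2 _) (ae_of_all _ fun x J' _ => ?_)
  · rw [norm_smul, norm_mul]
    have h1 : ‖J'‖ ≤ ‖J‖ + 1 := by
      have := norm_le_norm_add_norm_sub J J'
      rw [mem_ball_iff_norm'] at hJ'
      linarith
    have h2 : ‖ℓ x‖ ≤ Real.exp ‖ℓ x‖ := by linarith [Real.add_one_le_exp ‖ℓ x‖]
    have h3 : Real.exp ((‖J‖ + 1 + 1) * ‖ℓ x‖)
        = Real.exp ((‖J‖ + 1) * ‖ℓ x‖) * Real.exp ‖ℓ x‖ := by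
      rw [← Real.exp_add]; ring_nf
    rw [h3, ← mul_assoc]
    gcongr
    refine (norm_cexp_clm_le _ _).trans ?_
    gcongr
  · have := (((ℓ x).hasFDerivAt (x := J')).cexp).const_mul (w x)
    rw [mul_smul]
    exact this

theorem HasExpMoments.fderiv_apply (h : HasExpMoments μ ℓ w) (hℓ : AEStronglyMeasurable ℓ μ)
    (J v : E) : fderiv ℂ (laplaceTransform μ ℓ w) J v
      = laplaceTransform μ ℓ (fun x => w x * ℓ x v) J := by
  rw [(h.hasFDerivAt hℓ J).fderiv]
  have hi : Integrable (fun x => (w x * Complex.exp (ℓ x J)) • ℓ x) μ := by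
    have hm : AEStronglyMeasurable (fun x => ℓ x J) μ :=
      (ContinuousLinearMap.apply ℂ ℂ J).continuous.comp_aestronglyMeasurable hℓ
    refine (h.2 (‖J‖ + 1)).mono'
      ((h.1.mul (Complex.continuous_exp.comp_aestronglyMeasurable hm)).smul hℓ)
      (ae_of_all _ fun x => ?_)
    rw [norm_smul, norm_mul]
    have h2 : ‖ℓ x‖ ≤ Real.exp ‖ℓ x‖ := by linarith [Real.add_one_le_exp ‖ℓ x‖]
    have h3 : Real.exp ((‖J‖ + 1) * ‖ℓ x‖) = Real.exp (‖J‖ * ‖ℓ x‖) * Real.exp ‖ℓ x‖ := by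
      rw [← Real.exp_add]; ring_nf
    rw [h3, ← mul_assoc]
    gcongr
    exact norm_cexp_clm_le _ _
  rw [ContinuousLinearMap.integral_apply hi, laplaceTransform]
  refine integral_congr_ae (ae_of_all _ fun x => ?_)
  simp only [smul_apply, smul_eq_mul]
  ring

/-- Every directional derivative is again a Laplace transform of a weight in the same class, and in
finite dimension directional evaluations control the derivative; hence induction on the order. -/
theorem HasExpMoments.contDiff [FiniteDimensional ℂ E] (hℓ : AEStronglyMeasurable ℓ μ) (m : ℕ) :
    ∀ {w : X → ℂ}, HasExpMoments μ ℓ w → ContDiff ℂ m (laplaceTransform μ ℓ w) := by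
  induction m with
  | zero =>
    intro w h
    have hd : Differentiable ℂ (laplaceTransform μ ℓ w) := fun J =>
      (h.hasFDerivAt hℓ J).differentiableAt
    exact contDiff_zero.2 hd.continuous
  | succ m ih =>
    intro w h
    have hd : Differentiable ℂ (laplaceTransform μ ℓ w) := fun J =>
      (h.hasFDerivAt hℓ J).differentiableAt
    rw [show ((m + 1 : ℕ) : WithTop ℕ∞) = (m : WithTop ℕ∞) + 1 by norm_cast,
      contDiff_succ_iff_fderiv]
    refine ⟨hd, by simp, contDiff_clm_apply_iff.2 fun v => ?_⟩
    have : (fun J => fderiv ℂ (laplaceTransform μ ℓ w) J v)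
        = laplaceTransform μ ℓ (fun x => w x * ℓ x v) := funext fun J => h.fderiv_apply hℓ J v
    rw [this]
    exact ih (h.mul_apply hℓ v)

end laplace

/-! ### Continuous logarithms of smooth functions. -/

section logarithm

variable {E : Type*} [NormedAddCommGroup E] [NormedSpace ℂ E]

/-- Continuity fixes the branch: near `J` the function `W` is `W J` plus the principal logarithm of
`F / F J`, a quotient close to `1`. -/
theorem contDiffOn_of_cexp_eq {O : Set E} (hO : IsOpen O) {W F : E → ℂ} (hW : ContinuousOn W O)
    {m : WithTop ℕ∞} (hF : ContDiff ℂ m F) (h : ∀ J ∈ O, Complex.exp (W J) = F J) :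
    ContDiffOn ℂ m W O := by
  intro J hJ
  refine ContDiffAt.contDiffWithinAt ?_
  have hc : ContinuousAt W J := hW.continuousAt (hO.mem_nhds hJ)
  -- Within distance `π` the imaginary part of `W J' - W J` stays in the strip where `log` inverts
  -- `exp`.
  have h1 : ∀ᶠ J' in 𝓝 J, ‖W J' - W J‖ < Real.pi := by
    have : Tendsto (fun J' => ‖W J' - W J‖) (𝓝 J) (𝓝 0) := by
      have := (hc.sub (continuousAt_const (y := W J))).norm
      simpa [ContinuousAt] using this
    exact this.eventually_lt_const Real.pi_pos
  have h2 : W =ᶠ[𝓝 J] fun J' => W J + Complex.log (F J' / F J) := by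
    filter_upwards [h1, hO.mem_nhds hJ] with J' hlt hJ'
    have h3 := (Complex.abs_im_le_norm _).trans_lt hlt
    rw [abs_lt] at h3
    rw [← h J hJ, ← h J' hJ', ← Complex.exp_sub, Complex.log_exp h3.1 h3.2.le]
    ring
  have hne : F J ≠ 0 := by rw [← h J hJ]; exact Complex.exp_ne_zero _
  refine ContDiffAt.congr_of_eventuallyEq ?_ h2
  refine contDiffAt_const.add (ContDiffAt.comp J (Complex.contDiffAt_log ?_)
    (hF.contDiffAt.div_const _))
  rw [div_self hne]
  exact Complex.one_mem_slitPlane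

theorem fderiv_eq_of_cexp_eq {O : Set E} (hO : IsOpen O) {W F : E → ℂ}
    (hW : ContDiffOn ℂ 2 W O) (h : ∀ J ∈ O, Complex.exp (W J) = F J) {J : E} (hJ : J ∈ O) (v : E) :
    fderiv ℂ F J v = F J * fderiv ℂ W J v := by
  have hd : DifferentiableAt ℂ W J :=
    ((hW.contDiffAt (hO.mem_nhds hJ)).differentiableAt (by norm_num))
  have h1 : F =ᶠ[𝓝 J] fun J => Complex.exp (W J) := by
    filter_upwards [hO.mem_nhds hJ] with J' hJ' using (h J' hJ').symm
  rw [h1.fderiv_eq, hd.hasFDerivAt.cexp.fderiv, h J hJ]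
  rfl

/-- Second moments split into a connected part, which gives `G`, and a product of first derivatives,
which gives the products of classical fields. -/
theorem fderiv_fderiv_eq_of_cexp_eq {O : Set E} (hO : IsOpen O) {W F : E → ℂ}
    (hW : ContDiffOn ℂ 2 W O) (h : ∀ J ∈ O, Complex.exp (W J) = F J) {J : E} (hJ : J ∈ O)
    (u v : E) :
    fderiv ℂ (fun J => fderiv ℂ F J v) J u
      = F J * (fderiv ℂ (fun J => fderiv ℂ W J v) J u + fderiv ℂ W J u * fderiv ℂ W J v) := by
  have h1 : (fun J => fderiv ℂ F J v) =ᶠ[𝓝 J] fun J => Complex.exp (W J) * fderiv ℂ W J v := by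
    filter_upwards [hO.mem_nhds hJ] with J' hJ'
    rw [fderiv_eq_of_cexp_eq hO hW h hJ', h J' hJ']
  have hat := hW.contDiffAt (hO.mem_nhds hJ)
  have hd : DifferentiableAt ℂ W J := hat.differentiableAt (by norm_num)
  have hd2 : DifferentiableAt ℂ (fun J => fderiv ℂ W J v) J := by
    have := (hat.fderiv_right (m := 1) (by norm_num)).differentiableAt (by norm_num)
    exact this.clm_apply (differentiableAt_const v)
  have hm := hd.hasFDerivAt.cexp.fun_mul hd2.hasFDerivAt
  rw [h1.fderiv_eq, hm.fderiv, ← h J hJ]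
  simp only [add_apply, smul_apply, smul_eq_mul]
  ring

end logarithm

/-! ### Complex Gaussian integrals with independent sources of `z` and `z̄`. -/

section gaussian

theorem gaussian_exponent_eq (ε : ℝ) (b c : ℂ) (v : Fin 2 → ℝ) :
    -(ε : ℂ) * (conj (Complex.measurableEquivPi.symm v) * Complex.measurableEquivPi.symm v)
      + b * conj (Complex.measurableEquivPi.symm v) + c * Complex.measurableEquivPi.symm v
    = -(ε : ℂ) * ∑ i, (v i : ℂ) ^ 2 + ∑ i, (![b + c, Complex.I * (c - b)] i) * v i := by
  simp only [Complex.measurableEquivPi_symm_apply, map_add, map_mul, Complex.conj_ofReal,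
    Complex.conj_I, Fin.sum_univ_two, Matrix.cons_val_zero, Matrix.cons_val_one]
  ring_nf
  rw [Complex.I_sq]
  ring

theorem integrable_complex_gaussian {ε : ℝ} (hε : 0 < ε) (b c : ℂ) :
    Integrable fun z : ℂ => Complex.exp (-(ε : ℂ) * (conj z * z) + b * conj z + c * z) := by
  rw [← Complex.volume_preserving_equiv_pi.symm.integrable_comp_emb
    Complex.measurableEquivPi.symm.measurableEmbedding]
  simp only [Function.comp_def, gaussian_exponent_eq]
  exact GaussianFourier.integrable_cexp_neg_mul_sum_add (by simpa using hε) _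

/-- In real coordinates the linear coefficients are `b + c` and `i(c - b)`; their squares add up to
`4bc`, which gives the exponent `bc/ε`. The numbers `b` and `c` need not be conjugate. -/
theorem integral_complex_gaussian {ε : ℝ} (hε : 0 < ε) (b c : ℂ) :
    ∫ z : ℂ, Complex.exp (-(ε : ℂ) * (conj z * z) + b * conj z + c * z)
      = (Real.pi / ε : ℝ) * Complex.exp (b * c / ε) := by
  rw [← Complex.volume_preserving_equiv_pi.symm.integral_comp
    Complex.measurableEquivPi.symm.measurableEmbedding]
  simp only [gaussian_exponent_eq]
  rw [GaussianFourier.integral_cexp_neg_mul_sum_add (by simpa using hε)]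
  have he : (ε : ℂ) ≠ 0 := by exact_mod_cast hε.ne'
  congr 1
  · simp
  · congr 1
    simp only [Fin.sum_univ_two, Matrix.cons_val_zero, Matrix.cons_val_one]
    field_simp
    ring_nf
    rw [Complex.I_sq]
    ring

theorem integrable_gaussian_field {ι : Type*} [Fintype ι] {ε : ℝ} (hε : 0 < ε) (b c : ι → ℂ) :
    Integrable fun z : ι → ℂ =>
      Complex.exp (∑ i, (-(ε : ℂ) * (conj (z i) * z i) + b i * conj (z i) + c i * z i)) := by
  simp_rw [Complex.exp_sum]
  exact Integrable.fintype_prod (f := fun i z =>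
    Complex.exp (-(ε : ℂ) * (conj z * z) + b i * conj z + c i * z))
    fun i => integrable_complex_gaussian hε _ _

theorem integral_gaussian_field {ι : Type*} [Fintype ι] {ε : ℝ} (hε : 0 < ε) (b c : ι → ℂ) :
    ∫ z : ι → ℂ,
      Complex.exp (∑ i, (-(ε : ℂ) * (conj (z i) * z i) + b i * conj (z i) + c i * z i))
      = ((Real.pi / ε) ^ Fintype.card ι : ℝ) * Complex.exp (∑ i, b i * c i / ε) := by
  simp_rw [Complex.exp_sum]
  rw [integral_fintype_prod_volume_eq_prod (f := fun i z =>
    Complex.exp (-(ε : ℂ) * (conj z * z) + b i * conj z + c i * z))]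
  simp_rw [integral_complex_gaussian hε, Finset.prod_mul_distrib]
  simp [div_pow]

end gaussian

/-! ### Integrability of the dominating function. -/

section decay

theorem integrable_exp_neg_norm {V : Type*} [NormedAddCommGroup V] [NormedSpace ℝ V]
    [FiniteDimensional ℝ V] [MeasurableSpace V] [BorelSpace V] (μ : Measure V)
    [μ.IsAddHaarMeasure] : Integrable (fun x : V => Real.exp (-‖x‖)) μ := by
  -- One power more than the dimension makes `(1 + ‖x‖)^(-m)` integrable, and `(1 + ‖x‖)^m / m! ≤
  -- exp(1 + ‖x‖)` compares it with the exponential.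
  set m := Module.finrank ℝ V + 1 with hm
  have h := integrable_one_add_norm (E := V) (μ := μ) (r := (m : ℝ)) (by simp [hm])
  refine (h.const_mul (m.factorial * Real.exp 1)).mono'
    (Continuous.aestronglyMeasurable (by fun_prop)) (ae_of_all _ fun x => ?_)
  rw [Real.norm_of_nonneg (by positivity), Real.rpow_neg (by positivity), Real.rpow_natCast]
  have h1 := Real.pow_div_factorial_le_exp (1 + ‖x‖) (by positivity) m
  have h2 : 0 < (m.factorial : ℝ) := by positivity
  have h3 : 0 < (1 + ‖x‖) ^ m := by positivity
  rw [div_le_iff₀ h2, Real.exp_add] at h1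
  rw [Real.exp_neg, ← div_eq_mul_inv, le_div_iff₀ h3, inv_mul_eq_div, div_le_iff₀ (by positivity)]
  linarith

end decay

/-! ### Invariance of Lebesgue measure. -/

section rotation

/-- A linear automorphism that preserves a norm-like function preserves Lebesgue measure. -/
theorem measurePreserving_of_linear_isometry {ι : Type*} [Fintype ι]
    (f : (ι → ℂ) →ₗ[ℝ] (ι → ℂ)) (hf : ∀ x, ∑ i, ‖f x i‖ ^ 2 = ∑ i, ‖x i‖ ^ 2) :
    MeasurePreserving f volume volume := by
  have hker : LinearMap.ker f = ⊥ := by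
    rw [LinearMap.ker_eq_bot']
    intro x hx
    have h1 := hf x
    rw [hx] at h1
    simp only [Pi.zero_apply, norm_zero] at h1
    funext i
    have h2 := (Finset.sum_eq_zero_iff_of_nonneg (fun i _ => sq_nonneg ‖x i‖)).1
      (by rw [← h1]; simp) i (Finset.mem_univ i)
    simpa using h2
  have hdet : LinearMap.det f ≠ 0 := by
    rw [← isUnit_iff_ne_zero, ← LinearMap.isUnit_iff_isUnit_det]
    exact (LinearMap.isUnit_iff_ker_eq_bot f).2 hker
  -- The Euclidean ball is its own preimage and has positive finite volume, so the scaling factor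
  -- `|det f|⁻¹` must be `1`.
  set B : Set (ι → ℂ) := {x | ∑ i, ‖x i‖ ^ 2 < 1} with hB
  have hBo : IsOpen B := isOpen_lt (by fun_prop) continuous_const
  have hpos : volume B ≠ 0 := (hBo.measure_pos volume ⟨0, by simp [hB]⟩).ne'
  have hfin : volume B ≠ ⊤ := by
    refine ne_top_of_le_ne_top (measure_ball_lt_top (x := (0 : ι → ℂ)) (r := 2)).ne
      (measure_mono fun x hx => ?_)
    rw [mem_ball_zero_iff, pi_norm_lt_iff (by norm_num)]
    intro i
    have h1 : ‖x i‖ ^ 2 ≤ ∑ i, ‖x i‖ ^ 2 :=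
      Finset.single_le_sum (f := fun i => ‖x i‖ ^ 2) (fun _ _ => sq_nonneg _) (Finset.mem_univ i)
    have h2 : ∑ i, ‖x i‖ ^ 2 < 1 := hx
    nlinarith [norm_nonneg (x i)]
  have hpre : f ⁻¹' B = B := by
    ext x
    simp only [hB, Set.mem_preimage, Set.mem_ofPred_eq, hf]
  have h1 := Measure.addHaar_preimage_linearMap volume hdet B
  rw [hpre] at h1
  have h2 : ENNReal.ofReal |(LinearMap.det f)⁻¹| = 1 := by
    have : ENNReal.ofReal |(LinearMap.det f)⁻¹| * volume B = 1 * volume B := by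
      rw [one_mul]; exact h1.symm
    exact (ENNReal.mul_left_inj hpos hfin).1 this
  refine ⟨f.continuous_of_finiteDimensional.measurable, ?_⟩
  rw [Measure.map_linearMap_addHaar_eq_smul_addHaar volume hdet, h2, one_smul]

end rotation

/-! ### Fourier transform on the periodic lattice and the linear source coupling. -/

section fourier

variable {n N : ℕ} [NeZero n]

/-- The kernel of the lattice Fourier transform. -/
def fourierKernel (ε : ℝ) (l t : ZMod n) : ℂ :=
  (ε / Real.sqrt (2 * Real.pi) : ℝ) *
    Complex.exp (Complex.I * latticeFreq ε l * ((t.val : ℝ) * ε : ℝ))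

theorem fourierMode_eq (ε : ℝ) (f : LatticeField n N) (l : ZMod n) (i j : Fin N) :
    fourierMode ε f l i j = ∑ t, fourierKernel ε l t * f (t, i, j) := by
  simp only [fourierMode, fourierKernel, Finset.mul_sum, mul_assoc]

theorem freqStep_pos {ε : ℝ} (hε : 0 < ε) : 0 < freqStep n ε := by
  have : 0 < (n : ℝ) := Nat.cast_pos.2 (NeZero.pos n)
  unfold freqStep; positivity

/-- The spacings cancel in `ω_l t`, leaving `2π l t / n`, which matters only modulo `2π`. The chosen
integer representatives of `l` and `t` are therefore irrelevant, and the kernel is an additive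
character of `l * t`. -/
theorem fourierKernel_eq {ε : ℝ} (hε : 0 < ε) (l t : ZMod n) :
    fourierKernel ε l t = (ε / Real.sqrt (2 * Real.pi) : ℝ) * ZMod.stdAddChar (l * t) := by
  unfold fourierKernel
  congr 1
  have h : l * t = ((l.valMinAbs * (t.val : ℤ) : ℤ) : ZMod n) := by simp
  rw [h, ZMod.stdAddChar_coe]
  congr 1
  have hn : (n : ℂ) ≠ 0 := Nat.cast_ne_zero.2 (NeZero.ne n)
  have he : (ε : ℂ) ≠ 0 := by exact_mod_cast hε.ne'
  simp only [latticeFreq, freqStep]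
  push_cast
  field_simp

theorem conj_stdAddChar (x : ZMod n) : conj (ZMod.stdAddChar x) = ZMod.stdAddChar (-x) := by
  rw [ZMod.stdAddChar_apply, ← Circle.coe_inv_eq_conj, ZMod.stdAddChar_apply,
    AddChar.map_neg_eq_inv]

theorem conj_fourierKernel_mul {ε : ℝ} (hε : 0 < ε) (l t l' t' : ZMod n) :
    conj (fourierKernel ε l t) * fourierKernel ε l' t'
      = (ε ^ 2 / (2 * Real.pi) : ℝ) * ZMod.stdAddChar (l' * t' - l * t) := by
  rw [fourierKernel_eq hε, fourierKernel_eq hε, map_mul, Complex.conj_ofReal, conj_stdAddChar,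
    sub_eq_neg_add, AddChar.map_add_eq_mul]
  have : (ε ^ 2 / (2 * Real.pi) : ℝ)
      = ε / Real.sqrt (2 * Real.pi) * (ε / Real.sqrt (2 * Real.pi)) := by
    rw [div_mul_div_comm, Real.mul_self_sqrt (by positivity), pow_two]
  rw [this]
  push_cast
  ring

theorem sum_stdAddChar_mul (b : ZMod n) :
    ∑ x : ZMod n, (ZMod.stdAddChar (x * b) : ℂ) = if b = 0 then (n : ℂ) else 0 := by
  have := AddChar.sum_mulShift b (ZMod.isPrimitive_stdAddChar n)
  rw [this, ZMod.card]
  split_ifs <;> simp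

/-- Orthogonality of characters; the constants combine as `Δω · ε²/(2π) · n = ε`. -/
theorem sum_freq_fourierKernel {ε : ℝ} (hε : 0 < ε) (t t' : ZMod n) :
    (freqStep n ε : ℂ) * ∑ l, conj (fourierKernel ε l t) * fourierKernel ε l t'
      = if t = t' then (ε : ℂ) else 0 := by
  simp_rw [conj_fourierKernel_mul hε, ← mul_sub, ← Finset.mul_sum, sum_stdAddChar_mul, sub_eq_zero]
  have hn : (n : ℂ) ≠ 0 := Nat.cast_ne_zero.2 (NeZero.ne n)
  have he : (ε : ℂ) ≠ 0 := by exact_mod_cast hε.ne'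
  have hp : (Real.pi : ℂ) ≠ 0 := by exact_mod_cast Real.pi_ne_zero
  by_cases h : t' = t
  · rw [if_pos h, if_pos h.symm, freqStep]
    push_cast
    field_simp
  · rw [if_neg h, if_neg (Ne.symm h)]
    simp

theorem sum_time_fourierKernel {ε : ℝ} (hε : 0 < ε) (l l' : ZMod n) :
    (freqStep n ε : ℂ) * ∑ t, conj (fourierKernel ε l t) * fourierKernel ε l' t
      = if l = l' then (ε : ℂ) else 0 := by
  have h1 : ∀ t : ZMod n, l' * t - l * t = t * (l' - l) := fun t => by ring
  simp_rw [conj_fourierKernel_mul hε, h1, ← Finset.mul_sum, sum_stdAddChar_mul, sub_eq_zero]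
  have hn : (n : ℂ) ≠ 0 := Nat.cast_ne_zero.2 (NeZero.ne n)
  have he : (ε : ℂ) ≠ 0 := by exact_mod_cast hε.ne'
  have hp : (Real.pi : ℂ) ≠ 0 := by exact_mod_cast Real.pi_ne_zero
  by_cases h : l' = l
  · rw [if_pos h, if_pos h.symm, freqStep]
    push_cast
    field_simp
  · rw [if_neg h, if_neg (Ne.symm h)]
    simp

/-- Parseval's identity on the time lattice. -/
theorem sum_conj_fourierMode_mul {ε : ℝ} (hε : 0 < ε) (f g : LatticeField n N)
    (i j i' j' : Fin N) :
    (freqStep n ε : ℂ) * ∑ l, conj (fourierMode ε f l i j) * fourierMode ε g l i' j'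
      = ε * ∑ t, conj (f (t, i, j)) * g (t, i', j') := by
  have h1 : ∀ l, conj (fourierMode ε f l i j) * fourierMode ε g l i' j'
      = ∑ t, ∑ t', conj (f (t, i, j)) * g (t', i', j') *
        (conj (fourierKernel ε l t) * fourierKernel ε l t') := fun l => by
    rw [fourierMode_eq, fourierMode_eq, map_sum, Finset.sum_mul_sum]
    refine Finset.sum_congr rfl fun t _ => Finset.sum_congr rfl fun t' _ => ?_
    rw [map_mul]; ring
  simp_rw [h1]
  rw [Finset.sum_comm, Finset.mul_sum, Finset.mul_sum]
  refine Finset.sum_congr rfl fun t _ => ?_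
  rw [Finset.sum_comm, Finset.mul_sum]
  have h2 : ∀ t', (freqStep n ε : ℂ) * ∑ l, conj (f (t, i, j)) * g (t', i', j') *
        (conj (fourierKernel ε l t) * fourierKernel ε l t')
      = conj (f (t, i, j)) * g (t', i', j') * (if t = t' then (ε : ℂ) else 0) := fun t' => by
    rw [← sum_freq_fourierKernel hε, ← Finset.mul_sum]; ring
  simp_rw [h2, mul_ite, mul_zero]
  rw [Finset.sum_ite_eq]
  simp only [Finset.mem_univ, if_true]
  ring

theorem sum_sourceKind {M : Type*} [AddCommMonoid M] (f : SourceKind → M) :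
    ∑ κ, f κ = f .L + (f .Lbar + (f .Lt + f .Ltbar)) := by
  change Finset.sum {SourceKind.L, SourceKind.Lbar, SourceKind.Lt, SourceKind.Ltbar} f = _
  rw [Finset.sum_insert (by decide), Finset.sum_insert (by decide), Finset.sum_insert (by decide),
    Finset.sum_singleton]

/-- The coefficients of the sources `L, L̄, L̃, conj L̃` once the response field has been replaced
by `-i A`. -/
def sourceModes (ε : ℝ) (M A : LatticeField n N) : LatticeSource n N := fun x =>
  match x.1 with
  | .L => conj (fourierMode ε M x.2.1 x.2.2.1 x.2.2.2)
  | .Lbar => fourierMode ε M x.2.1 x.2.2.1 x.2.2.2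
  | .Lt => -Complex.I * conj (fourierMode ε A x.2.1 x.2.2.1 x.2.2.2)
  | .Ltbar => -Complex.I * fourierMode ε A x.2.1 x.2.2.1 x.2.2.2

/-- The source term, linear in the sources, left by the integration over the response field. -/
def sourceCoupling (ε : ℝ) (M A : LatticeField n N) : LatticeSource n N →L[ℂ] ℂ :=
  ∑ x, ((freqStep n ε : ℂ) * sourceModes ε M A x) • ContinuousLinearMap.proj x

theorem sourceCoupling_apply (ε : ℝ) (M A : LatticeField n N) (J : LatticeSource n N) :
    sourceCoupling ε M A J = (freqStep n ε : ℂ) * ∑ l, ∑ i, ∑ j,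
      (J (.Lbar, l, i, j) * fourierMode ε M l i j + conj (fourierMode ε M l i j) * J (.L, l, i, j)
        + J (.Ltbar, l, i, j) * (-Complex.I * fourierMode ε A l i j)
        + (-Complex.I * conj (fourierMode ε A l i j)) * J (.Lt, l, i, j)) := by
  simp only [sourceCoupling, sum_apply, smul_apply, ContinuousLinearMap.proj_apply, smul_eq_mul]
  simp only [Fintype.sum_prod_type, sum_sourceKind, sourceModes, Finset.mul_sum,
    ← Finset.sum_add_distrib]
  refine Finset.sum_congr rfl fun l _ => Finset.sum_congr rfl fun i _ =>
    Finset.sum_congr rfl fun j _ => ?_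
  ring

theorem sourceCoupling_single (ε : ℝ) (M A : LatticeField n N)
    (x : SourceKind × ZMod n × Fin N × Fin N) :
    sourceCoupling ε M A (Pi.single x 1) = (freqStep n ε : ℂ) * sourceModes ε M A x := by
  simp only [sourceCoupling, sum_apply, smul_apply, ContinuousLinearMap.proj_apply, smul_eq_mul,
    Pi.single_apply, mul_ite, mul_one, mul_zero]
  simp

theorem continuous_fourierMode (ε : ℝ) (l : ZMod n) (i j : Fin N) :
    Continuous fun f : LatticeField n N => fourierMode ε f l i j := by
  simp_rw [fourierMode_eq]
  fun_prop

theorem continuous_sourceModes {Y : Type*} [TopologicalSpace Y] (ε : ℝ) {f g : Y → LatticeField n N}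
    (hf : Continuous f) (hg : Continuous g) (x : SourceKind × ZMod n × Fin N × Fin N) :
    Continuous fun y => sourceModes ε (f y) (g y) x := by
  have h1 := (continuous_fourierMode (n := n) ε x.2.1 x.2.2.1 x.2.2.2).comp hf
  have h2 := (continuous_fourierMode (n := n) ε x.2.1 x.2.2.1 x.2.2.2).comp hg
  obtain ⟨κ, l, i, j⟩ := x
  cases κ
  · exact Complex.continuous_conj.comp h1
  · exact h1
  · exact (Complex.continuous_conj.comp h2).const_mul _
  · exact h2.const_mul _

theorem continuous_sourceCoupling {Y : Type*} [TopologicalSpace Y] (ε : ℝ)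
    {f g : Y → LatticeField n N} (hf : Continuous f) (hg : Continuous g) :
    Continuous fun y => sourceCoupling ε (f y) (g y) := by
  unfold sourceCoupling
  exact continuous_finsetSum _ fun x _ =>
    ((continuous_sourceModes ε hf hg x).const_mul _).smul continuous_const

theorem exists_norm_fourierMode_le (n : ℕ) [NeZero n] (N : ℕ) (ε : ℝ) : ∃ c, 0 ≤ c ∧
    ∀ (f : LatticeField n N) l i j, ‖fourierMode ε f l i j‖ ≤ c * ‖f‖ := by
  refine ⟨∑ l : ZMod n, ∑ t, ‖fourierKernel ε l t‖, by positivity, fun f l i j => ?_⟩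
  rw [fourierMode_eq]
  calc ‖∑ t, fourierKernel ε l t * f (t, i, j)‖
      ≤ ∑ t, ‖fourierKernel ε l t‖ * ‖f‖ := by
        refine (norm_sum_le _ _).trans (Finset.sum_le_sum fun t _ => ?_)
        rw [norm_mul]
        gcongr
        exact norm_le_pi_norm f _
    _ = (∑ t, ‖fourierKernel ε l t‖) * ‖f‖ := by rw [Finset.sum_mul]
    _ ≤ _ := by
        refine mul_le_mul_of_nonneg_right ?_ (norm_nonneg _)
        exact Finset.single_le_sum (f := fun l => ∑ t, ‖fourierKernel ε l t‖)
          (fun _ _ => by positivity) (Finset.mem_univ l)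

theorem exists_norm_sourceModes_le (n : ℕ) [NeZero n] (N : ℕ) (ε : ℝ) : ∃ c, 0 ≤ c ∧
    ∀ (M A : LatticeField n N) x, ‖sourceModes ε M A x‖ ≤ c * (‖M‖ + ‖A‖) := by
  obtain ⟨c, hc, h⟩ := exists_norm_fourierMode_le n N ε
  refine ⟨c, hc, fun M A x => ?_⟩
  have h1 := h M x.2.1 x.2.2.1 x.2.2.2
  have h2 := h A x.2.1 x.2.2.1 x.2.2.2
  have h3 : 0 ≤ c * ‖M‖ := by positivity
  have h4 : 0 ≤ c * ‖A‖ := by positivity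
  obtain ⟨κ, l, i, j⟩ := x
  rw [mul_add]
  cases κ <;> simp only [sourceModes, norm_mul, norm_neg, Complex.norm_I, one_mul, RCLike.norm_conj]
    <;> linarith

theorem exists_norm_sourceCoupling_le (n : ℕ) [NeZero n] (N : ℕ) (ε : ℝ) : ∃ c, 0 ≤ c ∧
    ∀ M A : LatticeField n N, ‖sourceCoupling ε M A‖ ≤ c * (‖M‖ + ‖A‖) := by
  obtain ⟨c, hc, h⟩ := exists_norm_sourceModes_le n N ε
  refine ⟨∑ x : SourceKind × ZMod n × Fin N × Fin N, ‖(freqStep n ε : ℂ)‖ * c *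
    ‖(ContinuousLinearMap.proj x : LatticeSource n N →L[ℂ] ℂ)‖, by positivity, fun M A => ?_⟩
  refine (norm_sum_le _ _).trans ?_
  rw [Finset.sum_mul]
  refine Finset.sum_le_sum fun x _ => ?_
  rw [norm_smul, norm_mul]
  calc _ ≤ ‖(freqStep n ε : ℂ)‖ * (c * (‖M‖ + ‖A‖)) *
        ‖(ContinuousLinearMap.proj x : LatticeSource n N →L[ℂ] ℂ)‖ := by
        gcongr
        exact h M A x
    _ = _ := by ring

/-- The contact term `∫ dω L̃ · conj L̃` left by the integration over the response field. -/
def contactTerm (ε : ℝ) (J : LatticeSource n N) : ℂ :=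
  (freqStep n ε : ℂ) * ∑ l, ∑ i, ∑ j, J (.Lt, l, i, j) * J (.Ltbar, l, i, j)

end fourier

/-! ### Integration over the response field and exponential moments of the resulting weight. -/

namespace MSRModel

variable {n N : ℕ}

theorem continuous_force (S : MSRModel N) : Continuous S.force := by
  unfold force
  refine continuous_finsetSum _ fun p _ => ?_
  have h : Continuous fun M : Matrix (Fin N) (Fin N) ℂ => M.conjTranspose * M := by fun_prop
  have h' : Continuous fun M : Matrix (Fin N) (Fin N) ℂ => M * (M.conjTranspose * M) ^ (p - 1) :=
    continuous_id.matrix_mul (h.pow _)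
  exact Continuous.const_smul (M := ℂ) h' _

theorem continuous_langevinField (S : MSRModel N) (k ε : ℝ) :
    Continuous (S.langevinField k ε : LatticeField n N → LatticeField n N) := by
  refine continuous_pi fun p => ?_
  unfold langevinField langevin
  have h1 : Continuous fun M : LatticeField n N =>
      S.force (Matrix.of fun i' j' => M (p.1, i', j')) p.2.1 p.2.2 :=
    (S.continuous_force.comp (continuous_matrix fun i' j' => by
      exact continuous_apply _)).matrix_elem _ _
  fun_prop

variable [NeZero n]

/-- The weight `exp (-∫ dt Tr A† A)`, `A` the Langevin operator. -/
def gaussWeight (S : MSRModel N) (k ε : ℝ) (M : LatticeField n N) : ℂ :=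
  Complex.exp (-(ε : ℂ) * ∑ p, conj (S.langevinField k ε M p) * S.langevinField k ε M p)

/-- The time-domain sources of `χ̄` and `χ` including the Langevin operator. -/
def responseSource (S : MSRModel N) (k ε : ℝ) (J : LatticeSource n N) (M : LatticeField n N) :
    LatticeField n N := fun p =>
  -Complex.I * ε * S.langevinField k ε M p
    + freqStep n ε * ∑ l, conj (fourierKernel ε l p.1) * J (.Lt, l, p.2.1, p.2.2)

/-- See `responseSource`. -/
def responseSourceBar (S : MSRModel N) (k ε : ℝ) (J : LatticeSource n N) (M : LatticeField n N) :
    LatticeField n N := fun p =>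
  -Complex.I * ε * conj (S.langevinField k ε M p)
    + freqStep n ε * ∑ l, fourierKernel ε l p.1 * J (.Ltbar, l, p.2.1, p.2.2)

theorem sum_field (f : ZMod n × Fin N × Fin N → ℂ) :
    ∑ p, f p = ∑ t, ∑ i, ∑ j, f (t, i, j) := by
  simp only [Fintype.sum_prod_type]

theorem sum_field' (f : ZMod n × Fin N × Fin N → ℂ) :
    ∑ p, f p = ∑ i, ∑ j, ∑ t, f (t, i, j) := by
  rw [sum_field, Finset.sum_comm]
  refine Finset.sum_congr rfl fun i _ => Finset.sum_comm

theorem sum_field_comm (f : ZMod n → Fin N → Fin N → ℂ) :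
    ∑ i, ∑ j, ∑ l, f l i j = ∑ l, ∑ i, ∑ j, f l i j :=
  (sum_field' fun p => f p.1 p.2.1 p.2.2).symm.trans (sum_field _)

theorem sum_mul_sum_kernel (b : ZMod n → ZMod n → ℂ) (f g : ZMod n → ℂ) (Δ : ℂ) :
    ∑ t, (Δ * ∑ l, b l t * g l) * f t = Δ * ∑ l, g l * ∑ t, b l t * f t := by
  simp_rw [Finset.mul_sum, Finset.sum_mul]
  rw [Finset.sum_comm]
  refine Finset.sum_congr rfl fun l _ => Finset.sum_congr rfl fun t _ => ?_
  ring

theorem sum_kernel_mul (ε : ℝ) (κ : SourceKind) (J : LatticeSource n N) (χ : LatticeField n N) :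
    ∑ p : ZMod n × Fin N × Fin N,
        (freqStep n ε * ∑ l, fourierKernel ε l p.1 * J (κ, l, p.2.1, p.2.2)) * χ p
      = freqStep n ε * ∑ l, ∑ i, ∑ j, J (κ, l, i, j) * fourierMode ε χ l i j := by
  rw [sum_field']
  simp only [sum_mul_sum_kernel, fourierMode_eq, ← Finset.mul_sum]
  rw [sum_field_comm]

theorem sum_conj_kernel_mul (ε : ℝ) (κ : SourceKind) (J : LatticeSource n N)
    (χ : LatticeField n N) :
    ∑ p : ZMod n × Fin N × Fin N,
        (freqStep n ε * ∑ l, conj (fourierKernel ε l p.1) * J (κ, l, p.2.1, p.2.2)) * conj (χ p)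
      = freqStep n ε * ∑ l, ∑ i, ∑ j, J (κ, l, i, j) * conj (fourierMode ε χ l i j) := by
  rw [sum_field']
  simp only [sum_mul_sum_kernel (fun l t => conj (fourierKernel ε l t)), fourierMode_eq, map_sum,
    map_mul, ← Finset.mul_sum]
  rw [sum_field_comm]

/-- For fixed `M` the exponent is `-ε|χ|²` plus terms linear in `χ` and `χ̄`, however nonlinear the
force is in `M`; the sources of `M` and `M̄` factor out. -/
theorem weight_eq (S : MSRModel N) (k ε : ℝ) (J : LatticeSource n N) (M χ : LatticeField n N) :
    S.weight k ε J M χ = Complex.exp (∑ p, (-(ε : ℂ) * (conj (χ p) * χ p)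
        + S.responseSource k ε J M p * conj (χ p) + S.responseSourceBar k ε J M p * χ p))
      * Complex.exp ((freqStep n ε : ℂ) * ∑ l, ∑ i, ∑ j, (J (.Lbar, l, i, j) * fourierMode ε M l i j
        + conj (fourierMode ε M l i j) * J (.L, l, i, j))) := by
  rw [weight, ← Complex.exp_add]
  congr 1
  have h3 : ∑ p, (-(ε : ℂ) * (conj (χ p) * χ p)
        + S.responseSource k ε J M p * conj (χ p) + S.responseSourceBar k ε J M p * χ p)
      = -S.action k ε M χ
        + freqStep n ε * ∑ l, ∑ i, ∑ j, (J (.Ltbar, l, i, j) * fourierMode ε χ l i j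
          + conj (fourierMode ε χ l i j) * J (.Lt, l, i, j)) := by
    have e1 : freqStep n ε * ∑ l, ∑ i, ∑ j, (J (.Ltbar, l, i, j) * fourierMode ε χ l i j
          + conj (fourierMode ε χ l i j) * J (.Lt, l, i, j))
        = ∑ p : ZMod n × Fin N × Fin N,
          ((freqStep n ε * ∑ l, conj (fourierKernel ε l p.1) * J (.Lt, l, p.2.1, p.2.2))
            * conj (χ p)
          + (freqStep n ε * ∑ l, fourierKernel ε l p.1 * J (.Ltbar, l, p.2.1, p.2.2)) * χ p) := by
      rw [Finset.sum_add_distrib, sum_kernel_mul, sum_conj_kernel_mul, ← mul_add]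
      simp only [← Finset.sum_add_distrib]
      congr 1
      refine Finset.sum_congr rfl fun l _ => Finset.sum_congr rfl fun i _ =>
        Finset.sum_congr rfl fun j _ => ?_
      ring
    rw [e1, action, ← sum_field (fun p => conj (χ p) * χ p
      + Complex.I * conj (χ p) * S.langevin k ε M p.1 p.2.1 p.2.2
      + Complex.I * conj (S.langevin k ε M p.1 p.2.1 p.2.2) * χ p), Finset.mul_sum,
      ← Finset.sum_neg_distrib, ← Finset.sum_add_distrib]
    refine Finset.sum_congr rfl fun p _ => ?_
    simp only [responseSource, responseSourceBar, langevinField]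
    ring
  rw [h3, sourceTerm, add_assoc, ← mul_add]
  congr 2
  simp only [← Finset.sum_add_distrib]
  refine Finset.sum_congr rfl fun l _ => Finset.sum_congr rfl fun i _ =>
    Finset.sum_congr rfl fun j _ => ?_
  ring

theorem integrable_weight (S : MSRModel N) (k : ℝ) {ε : ℝ} (hε : 0 < ε) (J : LatticeSource n N)
    (M : LatticeField n N) : Integrable fun χ : LatticeField n N => S.weight k ε J M χ := by
  simp_rw [weight_eq]
  exact (integrable_gaussian_field hε _ _).mul_const _

/-- This is the part of the Gaussian exponent that does not involve `M`. Orthogonality of the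
kernels collapses the two frequency sums into one, and the factor `ε` cancels the `1/ε` of the
Gaussian formula. -/
theorem sum_contact {ε : ℝ} (hε : 0 < ε) (J : LatticeSource n N) :
    ∑ p : ZMod n × Fin N × Fin N,
      (freqStep n ε * ∑ l, conj (fourierKernel ε l p.1) * J (.Lt, l, p.2.1, p.2.2))
      * (freqStep n ε * ∑ l, fourierKernel ε l p.1 * J (.Ltbar, l, p.2.1, p.2.2))
      = ε * contactTerm ε J := by
  have h1 : ∀ i j, ∑ t : ZMod n,
      (freqStep n ε * ∑ l, conj (fourierKernel ε l t) * J (.Lt, l, i, j))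
      * (freqStep n ε * ∑ l, fourierKernel ε l t * J (.Ltbar, l, i, j))
      = freqStep n ε * ∑ l, ε * (J (.Lt, l, i, j) * J (.Ltbar, l, i, j)) := by
    intro i j
    rw [sum_mul_sum_kernel (fun l t => conj (fourierKernel ε l t))]
    congr 1
    refine Finset.sum_congr rfl fun l _ => ?_
    have h2 : ∑ t, conj (fourierKernel ε l t) * (freqStep n ε * ∑ l', fourierKernel ε l' t *
          J (.Ltbar, l', i, j))
        = ∑ l', (freqStep n ε * ∑ t, conj (fourierKernel ε l t) * fourierKernel ε l' t) *
          J (.Ltbar, l', i, j) := by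
      simp_rw [Finset.mul_sum, Finset.sum_mul]
      rw [Finset.sum_comm]
      refine Finset.sum_congr rfl fun l _ => Finset.sum_congr rfl fun t _ => ?_
      ring
    rw [h2]
    simp_rw [sum_time_fourierKernel hε, ite_mul, zero_mul]
    rw [Finset.sum_ite_eq]
    simp only [Finset.mem_univ, if_true]
    ring
  rw [sum_field']
  simp only [h1]
  rw [contactTerm]
  simp only [← Finset.mul_sum]
  rw [mul_left_comm]
  congr 2
  exact sum_field_comm _

/-- With linear coefficients `-iεA + …` and `-iεĀ + …`, the exponent `bc/ε` has three parts:
`-ε|A|²`, the cross terms, which are the source term at `χ = -iA`, and the contact term. -/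
theorem integral_weight (S : MSRModel N) (k : ℝ) {ε : ℝ} (hε : 0 < ε) (J : LatticeSource n N)
    (M : LatticeField n N) :
    ∫ χ : LatticeField n N, S.weight k ε J M χ
      = ((Real.pi / ε) ^ Fintype.card (ZMod n × Fin N × Fin N) : ℝ)
        * Complex.exp (contactTerm ε J)
        * (S.gaussWeight k ε M
          * Complex.exp (sourceCoupling ε M (S.langevinField k ε M) J)) := by
  have he : (ε : ℂ) ≠ 0 := by exact_mod_cast hε.ne'
  simp_rw [weight_eq]
  rw [integral_mul_const, integral_gaussian_field hε, gaussWeight, mul_assoc, mul_assoc,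
    ← Complex.exp_add, ← Complex.exp_add, ← Complex.exp_add]
  congr 2
  have h1 : ∀ p, S.responseSource k ε J M p * S.responseSourceBar k ε J M p / ε
      = -(ε : ℂ) * (conj (S.langevinField k ε M p) * S.langevinField k ε M p)
        + -Complex.I * ((freqStep n ε * ∑ l, fourierKernel ε l p.1 * J (.Ltbar, l, p.2.1, p.2.2))
          * S.langevinField k ε M p)
        + -Complex.I * ((freqStep n ε * ∑ l, conj (fourierKernel ε l p.1) *
            J (.Lt, l, p.2.1, p.2.2)) * conj (S.langevinField k ε M p))
        + (ε : ℂ)⁻¹ * ((freqStep n ε * ∑ l, conj (fourierKernel ε l p.1) *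
            J (.Lt, l, p.2.1, p.2.2))
          * (freqStep n ε * ∑ l, fourierKernel ε l p.1 * J (.Ltbar, l, p.2.1, p.2.2))) := by
    intro p
    simp only [responseSource, responseSourceBar]
    field_simp
    ring_nf
    rw [Complex.I_sq]
    ring
  simp_rw [h1, Finset.sum_add_distrib, ← Finset.mul_sum]
  rw [sum_kernel_mul, sum_conj_kernel_mul, sum_contact hε, sourceCoupling_apply,
    inv_mul_cancel_left₀ he]
  simp only [Finset.sum_add_distrib, mul_add, Finset.mul_sum]
  have h2 : ∀ l i j, (freqStep n ε : ℂ) * (J (.Ltbar, l, i, j) *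
      (-Complex.I * fourierMode ε (S.langevinField k ε M) l i j))
      = -Complex.I * (freqStep n ε * (J (.Ltbar, l, i, j) *
        fourierMode ε (S.langevinField k ε M) l i j)) := fun _ _ _ => by ring
  have h3 : ∀ l i j, (freqStep n ε : ℂ) * (-Complex.I *
      conj (fourierMode ε (S.langevinField k ε M) l i j) * J (.Lt, l, i, j))
      = -Complex.I * (freqStep n ε * (J (.Lt, l, i, j) *
        conj (fourierMode ε (S.langevinField k ε M) l i j))) := fun _ _ _ => by ring
  simp only [h2, h3]
  ring

theorem norm_gaussWeight (S : MSRModel N) (k ε : ℝ) (M : LatticeField n N) :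
    ‖S.gaussWeight k ε M‖ = Real.exp (-ε * ∑ p, ‖S.langevinField k ε M p‖ ^ 2) := by
  rw [gaussWeight, Complex.norm_exp]
  congr 1
  have : ∀ p, conj (S.langevinField k ε M p) * S.langevinField k ε M p
      = ((‖S.langevinField k ε M p‖ ^ 2 : ℝ) : ℂ) := fun p => by
    rw [← Complex.normSq_eq_conj_mul_self, Complex.sq_norm]
  simp_rw [this, ← Complex.ofReal_sum, ← Complex.ofReal_neg, ← Complex.ofReal_mul,
    Complex.ofReal_re]

/-- The weight decays faster than any exponential of the field and the Langevin operator. -/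
theorem exists_norm_gaussWeight_mul_exp_le [NeZero N] (S : MSRModel N) (hdeg : 2 ≤ S.deg)
    (ha : S.a S.deg ≠ 0) (k : ℝ) {ε : ℝ} (hε : 0 < ε) (R : ℝ) :
    ∃ C, 0 ≤ C ∧ ∀ M : LatticeField n N,
      ‖S.gaussWeight k ε M‖ * Real.exp (R * (‖M‖ + ‖S.langevinField k ε M‖))
        ≤ C * Real.exp (-‖M‖) := by
  -- The slope `R + 1` pays for `R‖M‖` and for the factor `exp(-‖M‖)` to be gained. The price `‖A‖`
  -- joins `R‖A‖` and is absorbed in `ε‖A‖²` by completing the square.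
  obtain ⟨C, hC⟩ := S.exists_mul_norm_le_langevinField (n := n) hdeg ha k hε (R + 1)
  refine ⟨Real.exp (C + (R + 1) ^ 2 / (4 * ε)), by positivity, fun M => ?_⟩
  set A := S.langevinField k ε M with hA
  rw [norm_gaussWeight, ← Real.exp_add, ← Real.exp_add, Real.exp_le_exp, ← hA]
  have h1 : ‖A‖ ^ 2 ≤ ∑ p, ‖A p‖ ^ 2 := by
    obtain ⟨p, -, hp⟩ := Finset.exists_max_image Finset.univ (fun p => ‖A p‖)
      (Finset.univ_nonempty (α := ZMod n × Fin N × Fin N))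
    have hAp : ‖A‖ ≤ ‖A p‖ :=
      (pi_norm_le_iff_of_nonneg (norm_nonneg _)).2 fun q => hp q (Finset.mem_univ q)
    calc ‖A‖ ^ 2 ≤ ‖A p‖ ^ 2 := by gcongr
      _ ≤ _ := Finset.single_le_sum (f := fun p => ‖A p‖ ^ 2) (fun _ _ => sq_nonneg _)
        (Finset.mem_univ p)
  have h2 := hC M
  rw [← hA] at h2
  have h3 : (R + 1) * ‖A‖ ≤ ε * ‖A‖ ^ 2 + (R + 1) ^ 2 / (4 * ε) := by
    have e : ε * ‖A‖ ^ 2 + (R + 1) ^ 2 / (4 * ε) - (R + 1) * ‖A‖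
        = ε * (‖A‖ - (R + 1) / (2 * ε)) ^ 2 := by field_simp; ring
    have : 0 ≤ ε * (‖A‖ - (R + 1) / (2 * ε)) ^ 2 := by positivity
    linarith
  have h4 := mul_le_mul_of_nonneg_left h1 hε.le
  linarith

theorem continuous_gaussWeight (S : MSRModel N) (k ε : ℝ) :
    Continuous (S.gaussWeight k ε : LatticeField n N → ℂ) := by
  have := S.continuous_langevinField (n := n) k ε
  unfold gaussWeight
  fun_prop

theorem continuous_sourceCoupling_langevinField (S : MSRModel N) (k ε : ℝ) :
    Continuous fun M : LatticeField n N => sourceCoupling ε M (S.langevinField k ε M) := by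
  have h := S.continuous_langevinField (n := n) k ε
  exact continuous_sourceCoupling ε continuous_id h

theorem hasExpMoments_gaussWeight [NeZero N] (S : MSRModel N) (hdeg : 2 ≤ S.deg)
    (ha : S.a S.deg ≠ 0) (k : ℝ) {ε : ℝ} (hε : 0 < ε) :
    HasExpMoments (volume : Measure (LatticeField n N))
      (fun M => sourceCoupling ε M (S.langevinField k ε M)) (S.gaussWeight k ε) := by
  obtain ⟨c, hc, h⟩ := exists_norm_sourceCoupling_le n N ε
  refine ⟨(S.continuous_gaussWeight k ε).aestronglyMeasurable, fun R => ?_⟩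
  obtain ⟨C, hC, hw⟩ := S.exists_norm_gaussWeight_mul_exp_le (n := n) hdeg ha k hε (|R| * c)
  refine ((integrable_exp_neg_norm volume).const_mul C).mono' ?_ (ae_of_all _ fun M => ?_)
  · exact Continuous.aestronglyMeasurable ((S.continuous_gaussWeight k ε).norm.mul
      (Real.continuous_exp.comp ((S.continuous_sourceCoupling_langevinField k ε).norm.const_mul R)))
  · rw [Real.norm_of_nonneg (by positivity)]
    refine le_trans ?_ (hw M)
    gcongr ?_ * Real.exp ?_
    rw [mul_assoc]
    exact (mul_le_mul_of_nonneg_right (le_abs_self R) (norm_nonneg _)).trans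
      (mul_le_mul_of_nonneg_left (h _ _) (abs_nonneg R))

theorem partitionFunction_eq (S : MSRModel N) (k : ℝ) {ε : ℝ} (hε : 0 < ε)
    (J : LatticeSource n N) :
    S.partitionFunction k ε J
      = ((Real.pi / ε) ^ Fintype.card (ZMod n × Fin N × Fin N) : ℝ)
        * Complex.exp (contactTerm ε J)
        * laplaceTransform volume (fun M => sourceCoupling ε M (S.langevinField k ε M))
          (S.gaussWeight k ε) J := by
  simp only [partitionFunction, integral_weight S k hε, integral_const_mul, laplaceTransform]

/-- Without sources the weight left after integrating out `χ` is a positive real function, so its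
integral is positive. -/
theorem partitionFunction_zero_ne_zero [NeZero N] (S : MSRModel N) (hdeg : 2 ≤ S.deg)
    (ha : S.a S.deg ≠ 0) (k : ℝ) {ε : ℝ} (hε : 0 < ε) :
    S.partitionFunction k ε (0 : LatticeSource n N) ≠ 0 := by
  rw [partitionFunction_eq S k hε]
  refine mul_ne_zero (mul_ne_zero ?_ (Complex.exp_ne_zero _)) ?_
  · have := Real.pi_pos
    exact_mod_cast (by positivity : (0 : ℝ) < (Real.pi / ε) ^ _).ne'
  have h1 : ∀ M : LatticeField n N, S.gaussWeight k ε M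
      = ((Real.exp (-ε * ∑ p, ‖S.langevinField k ε M p‖ ^ 2) : ℝ) : ℂ) := fun M => by
    rw [gaussWeight, Complex.ofReal_exp]
    congr 1
    push_cast
    simp_rw [← Complex.conj_mul']
  simp only [laplaceTransform, map_zero, Complex.exp_zero, mul_one, h1]
  rw [integral_complex_ofReal]
  have hm := (S.hasExpMoments_gaussWeight (n := n) hdeg ha k hε).2 0
  simp only [norm_gaussWeight, zero_mul, Real.exp_zero, mul_one] at hm
  exact_mod_cast (integral_exp_pos hm).ne'

end MSRModel

/-! ### One-parameter unitary groups and their action on lattice fields. -/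

theorem hasDerivAt_exp_smul_apply {N : ℕ} (X : Matrix (Fin N) (Fin N) ℂ) (s : ℝ) (i j : Fin N) :
    HasDerivAt (fun s : ℝ => NormedSpace.exp (s • X) i j) ((X * NormedSpace.exp (s • X)) i j) s := by
  let _ : NormedRing (Matrix (Fin N) (Fin N) ℂ) := Matrix.linftyOpNormedRing
  let _ : NormedAlgebra ℝ (Matrix (Fin N) (Fin N) ℂ) := Matrix.linftyOpNormedAlgebra
  have _ : FiniteDimensional ℝ (Matrix (Fin N) (Fin N) ℂ) :=
    inferInstanceAs (FiniteDimensional ℝ (Fin N → Fin N → ℂ))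
  have _ : CompleteSpace (Matrix (Fin N) (Fin N) ℂ) := FiniteDimensional.complete ℝ _
  let T0 : Matrix (Fin N) (Fin N) ℂ →ₗ[ℝ] ℂ :=
    { toFun := fun B => B i j
      map_add' := fun _ _ => rfl
      map_smul' := fun _ _ => rfl }
  exact (LinearMap.toContinuousLinearMap T0).hasFDerivAt.comp_hasDerivAt s
    (hasDerivAt_exp_smul_const' X s)

theorem exp_smul_unitary {N : ℕ} {X : Matrix (Fin N) (Fin N) ℂ} (hX : X.conjTranspose = -X)
    (s : ℝ) : (NormedSpace.exp (s • X)).conjTranspose * NormedSpace.exp (s • X) = 1 := by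
  have h : (s • X).conjTranspose = -(s • X) := by
    rw [Matrix.conjTranspose_smul, hX, smul_neg, star_trivial]
  rw [← Matrix.exp_conjTranspose, h, Matrix.exp_neg]
  exact Matrix.nonsing_inv_mul _ ((Matrix.isUnit_iff_isUnit_det _).1 (Matrix.isUnit_exp _))

theorem norm_apply_le_one_of_unitary {N : ℕ} {V : Matrix (Fin N) (Fin N) ℂ}
    (hV : V.conjTranspose * V = 1) (i j : Fin N) : ‖V i j‖ ≤ 1 := by
  have h := congrFun (congrFun hV j) j
  rw [Matrix.mul_apply, Matrix.one_apply_eq] at h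
  simp only [Matrix.conjTranspose_apply, Complex.star_def, Complex.conj_mul'] at h
  have h1 : ∑ a, ‖V a j‖ ^ 2 = 1 := by exact_mod_cast h
  have h2 : ‖V i j‖ ^ 2 ≤ ∑ a, ‖V a j‖ ^ 2 :=
    Finset.single_le_sum (f := fun a => ‖V a j‖ ^ 2) (fun _ _ => sq_nonneg _) (Finset.mem_univ i)
  nlinarith [norm_nonneg (V i j)]

/-- Left multiplication of a lattice field by a constant matrix. -/
def leftMul {n N : ℕ} (V : Matrix (Fin N) (Fin N) ℂ) (M : LatticeField n N) : LatticeField n N :=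
  fun p => ∑ b, V p.2.1 b * M (p.1, b, p.2.2)

section leftMul

variable {n N : ℕ}

theorem leftMul_apply (V : Matrix (Fin N) (Fin N) ℂ) (M : LatticeField n N) (t : ZMod n)
    (i j : Fin N) : leftMul V M (t, i, j) = (V * Matrix.of fun a b => M (t, a, b)) i j := rfl

theorem leftMul_leftMul (V V' : Matrix (Fin N) (Fin N) ℂ) (M : LatticeField n N) :
    leftMul V (leftMul V' M) = leftMul (V * V') M := by
  funext ⟨t, i, j⟩
  rw [leftMul_apply, leftMul_apply, mul_assoc]
  rfl

theorem leftMul_one (M : LatticeField n N) : leftMul 1 M = M := by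
  funext ⟨t, i, j⟩
  rw [leftMul_apply, one_mul]
  rfl

theorem leftMul_add_smul (Y Z : Matrix (Fin N) (Fin N) ℂ) (c : ℂ) (M : LatticeField n N)
    (p : ZMod n × Fin N × Fin N) :
    leftMul (Y + c • Z) M p = leftMul Y M p + c * leftMul Z M p := by
  simp only [leftMul, Matrix.add_apply, Matrix.smul_apply, smul_eq_mul, add_mul,
    Finset.sum_add_distrib, Finset.mul_sum, mul_assoc]

variable [NeZero n]

theorem exists_norm_leftMul_le (X : Matrix (Fin N) (Fin N) ℂ) : ∃ c, 0 ≤ c ∧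
    ∀ M : LatticeField n N, ∀ p, ‖leftMul X M p‖ ≤ c * ‖M‖ := by
  refine ⟨∑ a, ∑ b, ‖X a b‖, by positivity, fun M p => ?_⟩
  calc ‖leftMul X M p‖ ≤ ∑ b, ‖X p.2.1 b‖ * ‖M‖ := by
        refine (norm_sum_le _ _).trans (Finset.sum_le_sum fun b _ => ?_)
        rw [norm_mul]
        gcongr
        exact norm_le_pi_norm M _
    _ = (∑ b, ‖X p.2.1 b‖) * ‖M‖ := by rw [Finset.sum_mul]
    _ ≤ _ := mul_le_mul_of_nonneg_right (Finset.single_le_sum (f := fun a => ∑ b, ‖X a b‖)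
        (fun _ _ => by positivity) (Finset.mem_univ _)) (norm_nonneg _)

theorem norm_leftMul_le_of_unitary {V : Matrix (Fin N) (Fin N) ℂ}
    (hV : V.conjTranspose * V = 1) (M : LatticeField n N) : ‖leftMul V M‖ ≤ N * ‖M‖ := by
  refine (pi_norm_le_iff_of_nonneg (by positivity)).2 fun p => ?_
  calc ‖leftMul V M p‖ ≤ ∑ b : Fin N, ‖M‖ := by
        refine (norm_sum_le _ _).trans (Finset.sum_le_sum fun b _ => ?_)
        rw [norm_mul, ← one_mul ‖M‖]
        exact mul_le_mul (norm_apply_le_one_of_unitary hV _ _) (norm_le_pi_norm M _)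
          (norm_nonneg _) zero_le_one
    _ = _ := by simp

/-- The upper bound applied to the inverse `V†`. The constant does not depend on `V`, which makes
the domination along the rotation uniform. -/
theorem norm_le_norm_leftMul_of_unitary {V : Matrix (Fin N) (Fin N) ℂ}
    (hV : V.conjTranspose * V = 1) (M : LatticeField n N) : ‖M‖ ≤ N * ‖leftMul V M‖ := by
  have h := norm_leftMul_le_of_unitary (V := V.conjTranspose)
    (by rw [Matrix.conjTranspose_conjTranspose]; exact mul_eq_one_comm.1 hV) (leftMul V M)
  rwa [leftMul_leftMul, hV, leftMul_one] at h

theorem sum_field_column {A : Type*} [AddCommMonoid A] (f : ZMod n × Fin N × Fin N → A) :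
    ∑ p, f p = ∑ t, ∑ j, ∑ i, f (t, i, j) := by
  simp only [Fintype.sum_prod_type]
  exact Finset.sum_congr rfl fun t _ => Finset.sum_comm

/-- At each time `Tr (Vm)†(Vm) = Tr m†m`, so the map is a Euclidean isometry of the whole field
space. -/
theorem measurePreserving_leftMul {V : Matrix (Fin N) (Fin N) ℂ}
    (hV : V.conjTranspose * V = 1) :
    MeasurePreserving (leftMul V : LatticeField n N → LatticeField n N) volume volume := by
  let f : LatticeField n N →ₗ[ℝ] LatticeField n N :=
    { toFun := leftMul V
      map_add' := fun M M' => by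
        funext p
        simp only [leftMul, Pi.add_apply, mul_add, Finset.sum_add_distrib]
      map_smul' := fun c M => by
        funext p
        simp only [leftMul, Pi.smul_apply, Complex.real_smul, RingHom.id_apply, Finset.mul_sum]
        exact Finset.sum_congr rfl fun b _ => by ring }
  refine measurePreserving_of_linear_isometry f fun M => ?_
  change ∑ p, ‖leftMul V M p‖ ^ 2 = _
  simp only [sum_field_column]
  refine Finset.sum_congr rfl fun t _ => ?_
  set m : Matrix (Fin N) (Fin N) ℂ := Matrix.of fun a b => M (t, a, b) with hm
  have h1 := trace_conjTranspose_mul_self_re (V * m)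
  rw [Matrix.conjTranspose_mul, mul_assoc, ← mul_assoc V.conjTranspose, hV, one_mul,
    trace_conjTranspose_mul_self_re] at h1
  rw [Finset.sum_comm, Finset.sum_comm (f := fun j i => ‖M (t, i, j)‖ ^ 2)]
  exact h1.symm

end leftMul

/-! ### Response of the weight to unitary rotations, and the integrated identity. -/

namespace MSRModel

variable {n N : ℕ}

theorem force_unitary_mul (S : MSRModel N) {V : Matrix (Fin N) (Fin N) ℂ}
    (hV : V.conjTranspose * V = 1) (m : Matrix (Fin N) (Fin N) ℂ) :
    S.force (V * m) = V * S.force m := by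
  have h : (V * m).conjTranspose * (V * m) = m.conjTranspose * m := by
    rw [Matrix.conjTranspose_mul, mul_assoc, ← mul_assoc V.conjTranspose, hV, one_mul]
  rw [force_eq, force_eq, h, mul_assoc]

/-- The variation of the Langevin operator under left multiplication of the field. -/
def langevinVar (S : MSRModel N) (k ε : ℝ) (X : Matrix (Fin N) (Fin N) ℂ) (M : LatticeField n N) :
    LatticeField n N := fun p =>
  ∑ b, X p.2.1 b * (S.langevinField k ε M (p.1, b, p.2.2)
    + (S.energy k p.2.1 p.2.2 - S.energy k b p.2.2 : ℝ) * M (p.1, b, p.2.2))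

/-- A constant `V` commutes with the time difference and passes through the force; moving it past
the energy produces the differences `E_i - E_b`. -/
theorem langevinField_leftMul (S : MSRModel N) (k ε : ℝ) {V : Matrix (Fin N) (Fin N) ℂ}
    (hV : V.conjTranspose * V = 1) (M : LatticeField n N) :
    S.langevinField k ε (leftMul V M) = S.langevinVar k ε V M := by
  funext ⟨t, i, j⟩
  have h1 : S.force (Matrix.of fun a b => leftMul V M (t, a, b))
      = V * S.force (Matrix.of fun a b => M (t, a, b)) := by
    rw [← S.force_unitary_mul hV]
    rfl
  simp only [langevinField, langevin, langevinVar]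
  rw [h1, Matrix.mul_apply]
  simp only [leftMul]
  rw [← Finset.sum_sub_distrib, Finset.sum_div, Finset.mul_sum, ← Finset.sum_add_distrib,
    ← Finset.sum_add_distrib]
  refine Finset.sum_congr rfl fun b _ => ?_
  push_cast
  ring

/-- The energy differences telescope: `(E_i - E_b) + (E_b - E_c) = E_i - E_c`. This gives the
derivative along `exp(sX)` at every `s`, not only at `0`. -/
theorem langevinVar_leftMul (S : MSRModel N) (k ε : ℝ) (X : Matrix (Fin N) (Fin N) ℂ)
    {V : Matrix (Fin N) (Fin N) ℂ} (hV : V.conjTranspose * V = 1) (M : LatticeField n N) :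
    S.langevinVar k ε X (leftMul V M) = S.langevinVar k ε (X * V) M := by
  funext ⟨t, i, j⟩
  simp only [langevinVar, S.langevinField_leftMul k ε hV, leftMul, Matrix.mul_apply,
    Finset.sum_mul, Finset.mul_sum, ← Finset.sum_add_distrib]
  rw [Finset.sum_comm]
  refine Finset.sum_congr rfl fun c _ => Finset.sum_congr rfl fun b _ => ?_
  push_cast
  ring

theorem langevinVar_add_smul (S : MSRModel N) (k ε : ℝ) (Y Z : Matrix (Fin N) (Fin N) ℂ) (c : ℂ)
    (M : LatticeField n N) (p : ZMod n × Fin N × Fin N) :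
    S.langevinVar k ε (Y + c • Z) M p
      = S.langevinVar k ε Y M p + c * S.langevinVar k ε Z M p := by
  simp only [langevinVar, Matrix.add_apply, Matrix.smul_apply, smul_eq_mul, add_mul,
    Finset.sum_add_distrib, Finset.mul_sum, mul_assoc]

theorem continuous_leftMul (X : Matrix (Fin N) (Fin N) ℂ) :
    Continuous (leftMul X : LatticeField n N → LatticeField n N) := by
  unfold leftMul
  fun_prop

theorem continuous_langevinVar (S : MSRModel N) (k ε : ℝ) (X : Matrix (Fin N) (Fin N) ℂ) :
    Continuous (S.langevinVar k ε X : LatticeField n N → LatticeField n N) := by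
  have := S.continuous_langevinField (n := n) k ε
  unfold langevinVar
  fun_prop

variable [NeZero n]

theorem exists_norm_langevinVar_le (S : MSRModel N) (k ε : ℝ) (X : Matrix (Fin N) (Fin N) ℂ) :
    ∃ c, 0 ≤ c ∧ ∀ M : LatticeField n N, ∀ p,
      ‖S.langevinVar k ε X M p‖ ≤ c * (‖M‖ + ‖S.langevinField k ε M‖) := by
  set c := ∑ a, ∑ b, ∑ j, ‖X a b‖ * (1 + |S.energy k a j - S.energy k b j|) with hc
  refine ⟨c, by positivity, fun M p => ?_⟩
  set r := ‖M‖ + ‖S.langevinField k ε M‖ with hr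
  have hr0 : 0 ≤ r := by positivity
  calc ‖S.langevinVar k ε X M p‖
      ≤ ∑ b, ‖X p.2.1 b‖ * (1 + |S.energy k p.2.1 p.2.2 - S.energy k b p.2.2|) * r := by
        refine (norm_sum_le _ _).trans (Finset.sum_le_sum fun b _ => ?_)
        rw [norm_mul, mul_assoc]
        gcongr
        refine (norm_add_le _ _).trans ?_
        rw [norm_mul, Complex.norm_real, Real.norm_eq_abs, add_mul, one_mul]
        have h1 := norm_le_pi_norm M (p.1, b, p.2.2)
        have h2 := norm_le_pi_norm (S.langevinField k ε M) (p.1, b, p.2.2)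
        have h3 := norm_nonneg M
        have h4 := norm_nonneg (S.langevinField k ε M)
        gcongr <;> linarith
    _ = (∑ b, ‖X p.2.1 b‖ * (1 + |S.energy k p.2.1 p.2.2 - S.energy k b p.2.2|)) * r := by
        rw [Finset.sum_mul]
    _ ≤ c * r := by
        refine mul_le_mul_of_nonneg_right ?_ hr0
        refine le_trans (Finset.sum_le_sum fun b _ => ?_) (Finset.single_le_sum (f := fun a =>
          ∑ b, ∑ j, ‖X a b‖ * (1 + |S.energy k a j - S.energy k b j|))
          (fun _ _ => by positivity) (Finset.mem_univ p.2.1))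
        exact Finset.single_le_sum (f := fun j =>
          ‖X p.2.1 b‖ * (1 + |S.energy k p.2.1 j - S.energy k b j|))
          (fun _ _ => by positivity) (Finset.mem_univ p.2.2)

/-- The variation of the exponent of the path integral under `M ↦ X M`, `M̄ ↦ -Xᵀ M̄`. -/
def exponentVar (S : MSRModel N) (k ε : ℝ) (J : LatticeSource n N) (X : Matrix (Fin N) (Fin N) ℂ)
    (M : LatticeField n N) : ℂ :=
  -(ε : ℂ) * ∑ p, (conj (S.langevinVar k ε (-X.conjTranspose) M p) * S.langevinField k ε M p
      + conj (S.langevinField k ε M p) * S.langevinVar k ε X M p)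
    + (freqStep n ε : ℂ) * ∑ l, ∑ i, ∑ j,
      (J (.Lbar, l, i, j) * fourierMode ε (leftMul X M) l i j
        + conj (fourierMode ε (leftMul (-X.conjTranspose) M) l i j) * J (.L, l, i, j)
        + J (.Ltbar, l, i, j) * (-Complex.I * fourierMode ε (S.langevinVar k ε X M) l i j)
        + (-Complex.I * conj (fourierMode ε (S.langevinVar k ε (-X.conjTranspose) M) l i j))
          * J (.Lt, l, i, j))

theorem fourierMode_add_mul (ε : ℝ) {f g h : LatticeField n N} {c : ℂ}
    (H : ∀ p, f p = g p + c * h p) (l : ZMod n) (i j : Fin N) :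
    fourierMode ε f l i j = fourierMode ε g l i j + c * fourierMode ε h l i j := by
  simp only [fourierMode_eq, H, mul_add, Finset.sum_add_distrib, Finset.mul_sum]
  congr 1
  exact Finset.sum_congr rfl fun t _ => by ring

/-- Conjugate fields are varied through `conj` of an expression in `-X†`; the two conjugations
cancel, so the dependence on `X` is complex-linear and not merely real-linear. -/
theorem exponentVar_add_smul (S : MSRModel N) (k ε : ℝ) (J : LatticeSource n N)
    (Y Z : Matrix (Fin N) (Fin N) ℂ) (c : ℂ) (M : LatticeField n N) :
    S.exponentVar k ε J (Y + c • Z) M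
      = S.exponentVar k ε J Y M + c * S.exponentVar k ε J Z M := by
  have e : -(Y + c • Z).conjTranspose = -Y.conjTranspose + conj c • -Z.conjTranspose := by
    rw [Matrix.conjTranspose_add, Matrix.conjTranspose_smul, Complex.star_def, smul_neg, neg_add]
  simp only [exponentVar, e, langevinVar_add_smul,
    fourierMode_add_mul ε (leftMul_add_smul Y Z c M),
    fourierMode_add_mul ε (leftMul_add_smul (-Y.conjTranspose) (-Z.conjTranspose) (conj c) M),
    fourierMode_add_mul ε (S.langevinVar_add_smul k ε Y Z c M),
    fourierMode_add_mul ε (S.langevinVar_add_smul k ε (-Y.conjTranspose) (-Z.conjTranspose)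
      (conj c) M), map_add, map_mul, Complex.conj_conj]
  rw [mul_add, ← mul_assoc c, mul_comm c (-(ε : ℂ)), mul_assoc _ c, add_add_add_comm, ← mul_add,
    mul_left_comm c, ← mul_add]
  simp only [Finset.mul_sum, ← Finset.sum_add_distrib]
  congr 1
  · exact Finset.sum_congr rfl fun p _ => by ring
  · exact Finset.sum_congr rfl fun l _ => Finset.sum_congr rfl fun i _ =>
      Finset.sum_congr rfl fun j _ => by ring

/-- The integrand of the path integral after integration over the response field. -/
def effWeight (S : MSRModel N) (k ε : ℝ) (J : LatticeSource n N) (M : LatticeField n N) : ℂ :=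
  S.gaussWeight k ε M * Complex.exp (sourceCoupling ε M (S.langevinField k ε M) J)

theorem hasDerivAt_fourierMode (ε : ℝ) {f : ℝ → LatticeField n N} {f' : LatticeField n N} {s : ℝ}
    (h : ∀ p, HasDerivAt (fun s => f s p) (f' p) s) (l : ZMod n) (i j : Fin N) :
    HasDerivAt (fun s => fourierMode ε (f s) l i j) (fourierMode ε f' l i j) s := by
  simp only [fourierMode_eq]
  exact HasDerivAt.fun_sum fun t _ => (h _).const_mul _

theorem hasDerivAt_conj {f : ℝ → ℂ} {f' : ℂ} {s : ℝ} (h : HasDerivAt f f' s) :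
    HasDerivAt (fun s => conj (f s)) (conj f') s :=
  Complex.conjCLE.toContinuousLinearMap.hasFDerivAt.comp_hasDerivAt s h

theorem hasDerivAt_effWeight (S : MSRModel N) (k ε : ℝ) (J : LatticeSource n N)
    {X : Matrix (Fin N) (Fin N) ℂ} (hX : X.conjTranspose = -X) (M : LatticeField n N) (s : ℝ) :
    HasDerivAt (fun s : ℝ => S.effWeight k ε J (leftMul (NormedSpace.exp (s • X)) M))
      (S.effWeight k ε J (leftMul (NormedSpace.exp (s • X)) M)
        * S.exponentVar k ε J X (leftMul (NormedSpace.exp (s • X)) M)) s := by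
  have hV := exp_smul_unitary hX
  have hM : ∀ p, HasDerivAt (fun s : ℝ => leftMul (NormedSpace.exp (s • X)) M p)
      (leftMul X (leftMul (NormedSpace.exp (s • X)) M) p) s := fun p => by
    rw [leftMul_leftMul]
    exact HasDerivAt.fun_sum fun b _ => (hasDerivAt_exp_smul_apply X s _ _).mul_const _
  have hA : ∀ p, HasDerivAt
      (fun s : ℝ => S.langevinField k ε (leftMul (NormedSpace.exp (s • X)) M) p)
      (S.langevinVar k ε X (leftMul (NormedSpace.exp (s • X)) M) p) s := fun p => by
    simp only [S.langevinVar_leftMul k ε X (hV s), S.langevinField_leftMul k ε (hV _)]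
    exact HasDerivAt.fun_sum fun b _ => (hasDerivAt_exp_smul_apply X s _ _).mul_const _
  -- Only for anti-Hermitian `X` are the formally independent variations of `M` and `M̄` conjugate
  -- to each other, hence a true derivative.
  have hX' : -X.conjTranspose = X := by rw [hX, neg_neg]
  simp only [effWeight, gaussWeight, ← Complex.exp_add, sourceCoupling_apply]
  refine HasDerivAt.cexp ?_
  unfold exponentVar
  rw [hX']
  refine HasDerivAt.fun_add (HasDerivAt.const_mul _ (HasDerivAt.fun_sum fun p _ =>
    (hasDerivAt_conj (hA p)).fun_mul (hA p))) (HasDerivAt.const_mul _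
    (HasDerivAt.fun_sum fun l _ => HasDerivAt.fun_sum fun i _ => HasDerivAt.fun_sum fun j _ => ?_))
  have h1 := hasDerivAt_fourierMode ε hM l i j
  have h2 := hasDerivAt_fourierMode ε hA l i j
  exact (((h1.const_mul _).fun_add ((hasDerivAt_conj h1).mul_const _)).fun_add
    ((h2.const_mul _).const_mul _)).fun_add (((hasDerivAt_conj h2).const_mul _).mul_const _)

theorem continuous_exponentVar (S : MSRModel N) (k ε : ℝ) (J : LatticeSource n N)
    (X : Matrix (Fin N) (Fin N) ℂ) : Continuous (S.exponentVar k ε J X) := by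
  have h0 := S.continuous_langevinField (n := n) k ε
  have h1 := S.continuous_langevinVar (n := n) k ε
  have h2 := continuous_leftMul (n := n) (N := N)
  unfold exponentVar
  simp only [fourierMode_eq]
  fun_prop

theorem continuous_effWeight (S : MSRModel N) (k ε : ℝ) (J : LatticeSource n N) :
    Continuous (S.effWeight k ε J) := by
  have h1 := S.continuous_sourceCoupling_langevinField (n := n) k ε
  have h2 := S.continuous_gaussWeight (n := n) k ε
  unfold effWeight
  exact h2.mul (Complex.continuous_exp.comp (h1.clm_apply continuous_const))

open Asymptotics in
-- The variation is at most quadratic in `‖M‖ + ‖A‖`, and a quadratic is dominated by the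
-- exponential. Big-O along the filter `⊤` expresses a bound valid on the whole space.
theorem exists_norm_exponentVar_le (S : MSRModel N) (k ε : ℝ) (J : LatticeSource n N)
    (X : Matrix (Fin N) (Fin N) ℂ) : ∃ c, 0 ≤ c ∧ ∀ M : LatticeField n N,
      ‖S.exponentVar k ε J X M‖ ≤ c * Real.exp (‖M‖ + ‖S.langevinField k ε M‖) := by
  set r : LatticeField n N → ℝ := fun M => ‖M‖ + ‖S.langevinField k ε M‖ with hr
  set g : LatticeField n N → ℝ := fun M => Real.exp (r M) with hg
  have hr0 : ∀ M, 0 ≤ r M := fun M => by positivity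
  obtain ⟨cF, hcF, hF⟩ := exists_norm_fourierMode_le n N ε
  have hr1 : r =O[⊤] g := isBigO_top.2 ⟨1, fun M => by
    rw [Real.norm_of_nonneg (hr0 M), hg, Real.norm_of_nonneg (Real.exp_pos _).le]
    linarith [Real.add_one_le_exp (r M)]⟩
  have hr2 : (fun M => r M * r M) =O[⊤] g := isBigO_top.2 ⟨2, fun M => by
    rw [Real.norm_of_nonneg (mul_self_nonneg _), hg, Real.norm_of_nonneg (Real.exp_pos _).le]
    have := Real.quadratic_le_exp_of_nonneg (hr0 M)
    nlinarith [hr0 M]⟩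
  have conjO : ∀ {f : LatticeField n N → ℂ} {h : LatticeField n N → ℝ}, f =O[⊤] h →
      (fun M => conj (f M)) =O[⊤] h := fun hf =>
    (isBigO_of_le _ fun M => (RCLike.norm_conj _).le).trans hf
  have hA : ∀ p, (fun M => S.langevinField k ε M p) =O[⊤] r := fun p =>
    isBigO_top.2 ⟨1, fun M => by
      rw [one_mul, Real.norm_of_nonneg (hr0 M)]
      have := norm_le_pi_norm (S.langevinField k ε M) p
      have := norm_nonneg M
      simp only [hr]; linarith⟩
  have hV : ∀ Y p, (fun M => S.langevinVar k ε Y M p) =O[⊤] r := fun Y p => by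
    obtain ⟨c, _, h⟩ := S.exists_norm_langevinVar_le (n := n) k ε Y
    exact isBigO_top.2 ⟨c, fun M => by rw [Real.norm_of_nonneg (hr0 M)]; exact h M p⟩
  have hL : ∀ Y p, (fun M : LatticeField n N => leftMul Y M p) =O[⊤] r := fun Y p => by
    obtain ⟨c, hc, h⟩ := exists_norm_leftMul_le (n := n) Y
    exact isBigO_top.2 ⟨c, fun M => by
      rw [Real.norm_of_nonneg (hr0 M)]
      refine (h M p).trans (mul_le_mul_of_nonneg_left ?_ hc)
      simp only [hr]; linarith [norm_nonneg (S.langevinField k ε M)]⟩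
  have hFour : ∀ {f : LatticeField n N → LatticeField n N}, (∀ p, (fun M => f M p) =O[⊤] r) →
      ∀ l i j, (fun M => fourierMode ε (f M) l i j) =O[⊤] g := fun hf l i j => by
    simp only [fourierMode_eq]
    exact IsBigO.fun_sum fun t _ => ((hf _).const_mul_left _).trans hr1
  have key : (S.exponentVar k ε J X) =O[⊤] g := by
    unfold exponentVar
    refine IsBigO.add (IsBigO.const_mul_left (IsBigO.fun_sum fun p _ => IsBigO.add
      (((conjO (hV _ p)).mul (hA p)).trans hr2) (((conjO (hA p)).mul (hV _ p)).trans hr2)) _)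
      (IsBigO.const_mul_left (IsBigO.fun_sum fun l _ => IsBigO.fun_sum fun i _ => IsBigO.fun_sum fun j _ => ?_) _)
    refine IsBigO.add (IsBigO.add (IsBigO.add ?_ ?_) ?_) ?_
    · exact (hFour (hL _) l i j).const_mul_left _
    · simp only [mul_comm _ (J _)]
      exact (conjO (hFour (hL _) l i j)).const_mul_left _
    · exact ((hFour (hV _) l i j).const_mul_left _).const_mul_left _
    · simp only [mul_comm _ (J _)]
      exact ((conjO (hFour (hV _) l i j)).const_mul_left _).const_mul_left _
  obtain ⟨c, hc, h⟩ := key.exists_nonneg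
  refine ⟨c, hc, fun M => ?_⟩
  have := isBigOWith_top.1 h M
  rwa [hg, Real.norm_of_nonneg (Real.exp_pos _).le] at this

theorem exists_norm_effWeight_mul_le [NeZero N] (S : MSRModel N) (hdeg : 2 ≤ S.deg)
    (ha : S.a S.deg ≠ 0) (k : ℝ) {ε : ℝ} (hε : 0 < ε) (J : LatticeSource n N)
    (X : Matrix (Fin N) (Fin N) ℂ) : ∃ C, 0 ≤ C ∧ ∀ M : LatticeField n N,
      ‖S.effWeight k ε J M * S.exponentVar k ε J X M‖ ≤ C * Real.exp (-‖M‖) := by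
  obtain ⟨c, hc, h⟩ := exists_norm_sourceCoupling_le n N ε
  obtain ⟨c', hc', h'⟩ := S.exists_norm_exponentVar_le k ε J X
  -- The rate `‖J‖ * c` covers the source term and the extra `1` covers the growth of the variation.
  obtain ⟨C, hC, hw⟩ := S.exists_norm_gaussWeight_mul_exp_le (n := n) hdeg ha k hε (‖J‖ * c + 1)
  refine ⟨c' * C, by positivity, fun M => ?_⟩
  have h1 := h M (S.langevinField k ε M)
  have h2 := h' M
  have h3 := hw M
  generalize ‖M‖ + ‖S.langevinField k ε M‖ = r at h1 h2 h3
  rw [effWeight, norm_mul, norm_mul]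
  calc _ ≤ ‖S.gaussWeight k ε M‖ * Real.exp (‖J‖ * (c * r)) * (c' * Real.exp r) := by
        gcongr
        refine (norm_cexp_clm_le _ _).trans (Real.exp_le_exp.2 ?_)
        gcongr
    _ = c' * (‖S.gaussWeight k ε M‖ * Real.exp ((‖J‖ * c + 1) * r)) := by
        have e : (‖J‖ * c + 1) * r = ‖J‖ * (c * r) + r := by ring
        rw [e, Real.exp_add]; ring
    _ ≤ c' * (C * Real.exp (-‖M‖)) := mul_le_mul_of_nonneg_left h3 hc'
    _ = _ := by ring

theorem integrable_effWeight_mul_exponentVar [NeZero N] (S : MSRModel N) (hdeg : 2 ≤ S.deg)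
    (ha : S.a S.deg ≠ 0) (k : ℝ) {ε : ℝ} (hε : 0 < ε) (J : LatticeSource n N)
    (X : Matrix (Fin N) (Fin N) ℂ) :
    Integrable fun M : LatticeField n N => S.effWeight k ε J M * S.exponentVar k ε J X M := by
  obtain ⟨C, hC, h⟩ := S.exists_norm_effWeight_mul_le hdeg ha k hε J X
  exact ((integrable_exp_neg_norm volume).const_mul C).mono'
    ((S.continuous_effWeight k ε J).mul (S.continuous_exponentVar k ε J X)).aestronglyMeasurable
    (ae_of_all _ h)

theorem integrable_effWeight [NeZero N] (S : MSRModel N) (hdeg : 2 ≤ S.deg)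
    (ha : S.a S.deg ≠ 0) (k : ℝ) {ε : ℝ} (hε : 0 < ε) (J : LatticeSource n N) :
    Integrable (S.effWeight k ε J) :=
  (S.hasExpMoments_gaussWeight hdeg ha k hε).integrable
    (S.continuous_sourceCoupling_langevinField k ε).aestronglyMeasurable J

/-- By invariance of the measure the integral of the rotated weight does not depend on `s`. Its
derivative at `s = 0`, taken under the integral sign, is the left side. -/
theorem integral_exponentVar_of_skew [NeZero N] (S : MSRModel N) (hdeg : 2 ≤ S.deg)
    (ha : S.a S.deg ≠ 0) (k : ℝ) {ε : ℝ} (hε : 0 < ε) (J : LatticeSource n N)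
    {X : Matrix (Fin N) (Fin N) ℂ} (hX : X.conjTranspose = -X) :
    ∫ M : LatticeField n N, S.effWeight k ε J M * S.exponentVar k ε J X M = 0 := by
  have hV := exp_smul_unitary hX
  have hN : 0 < (N : ℝ) := Nat.cast_pos.2 (NeZero.pos N)
  obtain ⟨C, hC, h⟩ := S.exists_norm_effWeight_mul_le (n := n) hdeg ha k hε J X
  have hconst : ∀ s : ℝ,
      ∫ M : LatticeField n N, S.effWeight k ε J (leftMul (NormedSpace.exp (s • X)) M)
        = ∫ M : LatticeField n N, S.effWeight k ε J M := fun s => by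
    have hmp := measurePreserving_leftMul (n := n) (hV s)
    rw [← hmp.map_eq, integral_map hmp.measurable.aemeasurable
      (S.continuous_effWeight k ε J).aestronglyMeasurable, hmp.map_eq]
  have hcont : ∀ s : ℝ, Continuous fun M : LatticeField n N =>
      S.effWeight k ε J (leftMul (NormedSpace.exp (s • X)) M) := fun s =>
    (S.continuous_effWeight k ε J).comp (continuous_leftMul _)
  -- The factor `N⁻¹` comes from `‖M‖ ≤ N ‖VM‖`, so one integrable function dominates for all `s`.
  have hbound : Integrable fun M : LatticeField n N => C * Real.exp (-‖(N : ℝ)⁻¹ • M‖) :=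
    ((integrable_exp_neg_norm (volume : Measure (LatticeField n N))).comp_smul
      (inv_ne_zero hN.ne')).const_mul C
  have hd := (hasDerivAt_integral_of_dominated_loc_of_deriv_le (μ := volume) (𝕜 := ℝ)
    (F := fun s (M : LatticeField n N) => S.effWeight k ε J (leftMul (NormedSpace.exp (s • X)) M))
    (F' := fun s M => S.effWeight k ε J (leftMul (NormedSpace.exp (s • X)) M)
        * S.exponentVar k ε J X (leftMul (NormedSpace.exp (s • X)) M))
    (x₀ := 0) (s := Set.univ) (bound := fun M => C * Real.exp (-‖(N : ℝ)⁻¹ • M‖))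
    univ_mem (Eventually.of_forall fun s => (hcont s).aestronglyMeasurable) ?_
    ((hcont 0).mul ((S.continuous_exponentVar k ε J X).comp
      (continuous_leftMul _))).aestronglyMeasurable
    (ae_of_all _ fun M s _ => ?_) hbound
    (ae_of_all _ fun M s _ => S.hasDerivAt_effWeight k ε J hX M s)).2
  · simp only [hconst, zero_smul, NormedSpace.exp_zero, leftMul_one] at hd
    exact hd.unique (hasDerivAt_const _ _)
  · simp only [zero_smul, NormedSpace.exp_zero, leftMul_one]
    exact S.integrable_effWeight hdeg ha k hε J
  · refine (h _).trans ?_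
    gcongr
    rw [norm_smul, norm_inv, Real.norm_of_nonneg hN.le, inv_mul_le_iff₀ hN]
    exact norm_le_norm_leftMul_of_unitary (hV s) M

/-- Every matrix is `Y + iZ` with `Y` and `Z` anti-Hermitian, and the variation is complex-linear.
-/
theorem integral_exponentVar [NeZero N] (S : MSRModel N) (hdeg : 2 ≤ S.deg)
    (ha : S.a S.deg ≠ 0) (k : ℝ) {ε : ℝ} (hε : 0 < ε) (J : LatticeSource n N)
    (X : Matrix (Fin N) (Fin N) ℂ) :
    ∫ M : LatticeField n N, S.effWeight k ε J M * S.exponentVar k ε J X M = 0 := by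
  set Y := (1 / 2 : ℂ) • (X - X.conjTranspose) with hY
  set Z := (-Complex.I / 2) • (X + X.conjTranspose) with hZ
  have hYs : Y.conjTranspose = -Y := by
    rw [hY, Matrix.conjTranspose_smul, Matrix.conjTranspose_sub,
      Matrix.conjTranspose_conjTranspose, ← smul_neg, neg_sub]
    simp
  have hZs : Z.conjTranspose = -Z := by
    rw [hZ, Matrix.conjTranspose_smul, Matrix.conjTranspose_add,
      Matrix.conjTranspose_conjTranspose, add_comm, ← neg_smul]
    simp [neg_div]
  have hX : X = Y + Complex.I • Z := by
    rw [hY, hZ, smul_smul]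
    have : Complex.I * (-Complex.I / 2) = 1 / 2 := by
      rw [mul_div_assoc', mul_neg, Complex.I_mul_I, neg_neg]
    rw [this, ← smul_add]
    ext i j
    simp
    ring
  have e : ∀ M : LatticeField n N, S.effWeight k ε J M * S.exponentVar k ε J X M
      = S.effWeight k ε J M * S.exponentVar k ε J Y M
        + Complex.I * (S.effWeight k ε J M * S.exponentVar k ε J Z M) := fun M => by
    conv_lhs => rw [hX]
    rw [exponentVar_add_smul]; ring
  simp_rw [e]
  rw [integral_add (S.integrable_effWeight_mul_exponentVar hdeg ha k hε J Y)
    ((S.integrable_effWeight_mul_exponentVar hdeg ha k hε J Z).const_mul _), integral_const_mul,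
    S.integral_exponentVar_of_skew hdeg ha k hε J hYs,
    S.integral_exponentVar_of_skew hdeg ha k hε J hZs]
  simp

end MSRModel

/-! ### The contact term, and the variation along a matrix unit in frequency space. -/

theorem sum_single_left {N : ℕ} {i i' : Fin N} (c : ℂ) (a : Fin N) (f : Fin N → ℂ) :
    ∑ b, Matrix.single i i' c a b * f b = if a = i then c * f i' else 0 := by
  by_cases h : a = i
  · subst h
    rw [if_pos rfl, Finset.sum_eq_single i']
    · rw [Matrix.single_apply_same]
    · intro b _ hb
      rw [Matrix.single_apply_of_col_ne _ _ hb.symm, zero_mul]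
    · simp
  · rw [if_neg h]
    exact Finset.sum_eq_zero fun b _ => by
      rw [Matrix.single_apply_of_row_ne (Ne.symm h), zero_mul]

section contact

variable {n N : ℕ} [NeZero n]

theorem hasFDerivAt_contactTerm (ε : ℝ) (J : LatticeSource n N) :
    HasFDerivAt (contactTerm ε : LatticeSource n N → ℂ)
      ((freqStep n ε : ℂ) • ∑ l, ∑ i, ∑ j,
        (J (.Lt, l, i, j) • ContinuousLinearMap.proj (R := ℂ) (φ := fun _ => ℂ)
            ((.Ltbar, l, i, j) : SourceKind × ZMod n × Fin N × Fin N)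
          + J (.Ltbar, l, i, j) • ContinuousLinearMap.proj (R := ℂ) (φ := fun _ => ℂ)
            ((.Lt, l, i, j) : SourceKind × ZMod n × Fin N × Fin N))) J := by
  unfold contactTerm
  refine HasFDerivAt.const_mul (HasFDerivAt.fun_sum fun l _ => HasFDerivAt.fun_sum fun i _ =>
    HasFDerivAt.fun_sum fun j _ => ?_) _
  exact HasFDerivAt.fun_mul (hasFDerivAt_apply _ J) (hasFDerivAt_apply _ J)

theorem contDiff_contactTerm (ε : ℝ) {m : WithTop ℕ∞} :
    ContDiff ℂ m (contactTerm ε : LatticeSource n N → ℂ) := by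
  unfold contactTerm
  fun_prop

theorem sum_field_ite (x : ZMod n × Fin N × Fin N) (f : ZMod n → Fin N → Fin N → ℂ) :
    ∑ l, ∑ i, ∑ j, (if (l, i, j) = x then f l i j else 0) = f x.1 x.2.1 x.2.2 := by
  rw [← MSRModel.sum_field fun p => if p = x then f p.1 p.2.1 p.2.2 else 0]
  simp

theorem fderiv_contactTerm_single (ε : ℝ) (J : LatticeSource n N) (κ : SourceKind)
    (l : ZMod n) (i j : Fin N) :
    fderiv ℂ (contactTerm ε) J (Pi.single (κ, l, i, j) 1)
      = freqStep n ε * (match κ with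
        | .L => 0
        | .Lbar => 0
        | .Lt => J (.Ltbar, l, i, j)
        | .Ltbar => J (.Lt, l, i, j)) := by
  rw [(hasFDerivAt_contactTerm ε J).fderiv]
  simp only [sum_apply, smul_apply, add_apply, ContinuousLinearMap.proj_apply,
    smul_eq_mul, Pi.single_apply]
  congr 1
  cases κ
  · simp
  · simp
  · simpa using sum_field_ite (l, i, j) fun l i j => J (.Ltbar, l, i, j)
  · simpa using sum_field_ite (l, i, j) fun l i j => J (.Lt, l, i, j)

end contact

namespace MSRModel

variable {n N : ℕ} [NeZero n]

/-- In the variation of `|A|²` the symmetric parts cancel, leaving energy differences, which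
Parseval's identity carries to frequency space. The terms with both `δE` and a source come from
varying `A` inside the source coupling; they will complete `η̄` and `η`. -/
theorem exponentVar_single (S : MSRModel N) (k : ℝ) {ε : ℝ} (hε : 0 < ε) (J : LatticeSource n N)
    (i i' : Fin N) (M : LatticeField n N) :
    S.exponentVar k ε J (Matrix.single i i' 1) M
      = (freqStep n ε : ℂ) * ∑ l, ∑ j,
        (Complex.I * (S.deltaE k i i' j : ℂ) *
          (sourceModes ε M (S.langevinField k ε M) (.Lt, l, i, j)
              * sourceModes ε M (S.langevinField k ε M) (.Lbar, l, i', j)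
            + J (.Ltbar, l, i, j) * sourceModes ε M (S.langevinField k ε M) (.Lbar, l, i', j)
            + sourceModes ε M (S.langevinField k ε M) (.Ltbar, l, i', j)
              * sourceModes ε M (S.langevinField k ε M) (.L, l, i, j)
            + J (.Lt, l, i', j) * sourceModes ε M (S.langevinField k ε M) (.L, l, i, j))
        + (J (.Lbar, l, i, j) * sourceModes ε M (S.langevinField k ε M) (.Lbar, l, i', j)
          - J (.L, l, i', j) * sourceModes ε M (S.langevinField k ε M) (.L, l, i, j)
          + J (.Ltbar, l, i, j) * sourceModes ε M (S.langevinField k ε M) (.Ltbar, l, i', j)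
          - J (.Lt, l, i', j) * sourceModes ε M (S.langevinField k ε M) (.Lt, l, i, j))) := by
  set A := S.langevinField k ε M with hA
  have hX : -(Matrix.single i i' (1 : ℂ)).conjTranspose = Matrix.single i' i (-1) := by
    rw [Matrix.conjTranspose_single, star_one]
    ext a b
    simp only [Matrix.neg_apply, Matrix.single_apply]
    split_ifs <;> simp
  have hmul : ∀ (c : ℂ) (a b : Fin N) (p : ZMod n × Fin N × Fin N),
      leftMul (Matrix.single a b c) M p = if p.2.1 = a then c * M (p.1, b, p.2.2) else 0 :=
    fun c a b p => sum_single_left c p.2.1 _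
  have hvar : ∀ (c : ℂ) (a b : Fin N) (p : ZMod n × Fin N × Fin N),
      S.langevinVar k ε (Matrix.single a b c) M p
        = if p.2.1 = a then c * (A (p.1, b, p.2.2)
          + (S.energy k p.2.1 p.2.2 - S.energy k b p.2.2 : ℝ) * M (p.1, b, p.2.2)) else 0 :=
    fun c a b p => sum_single_left c p.2.1 _
  have hsum : ∀ (a : Fin N) (f : Fin N → Fin N → ℂ),
      ∑ i, ∑ j, (if i = a then f i j else 0) = ∑ j, f a j := fun a f => by
    rw [Finset.sum_eq_single a]
    · simp
    · intro b _ hb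
      simp [hb]
    · simp
  have hF : ∀ (c : ℂ) (a b : Fin N) l i j, fourierMode ε (leftMul (Matrix.single a b c) M) l i j
      = if i = a then c * fourierMode ε M l b j else 0 := fun c a b l i j => by
    simp only [fourierMode_eq, hmul]
    split_ifs
    · rw [Finset.mul_sum]
      exact Finset.sum_congr rfl fun t _ => by ring
    · simp
  have hG : ∀ (c : ℂ) (a b : Fin N) l i j,
      fourierMode ε (S.langevinVar k ε (Matrix.single a b c) M) l i j
      = if i = a then c * (fourierMode ε A l b j
        + (S.energy k i j - S.energy k b j : ℝ) * fourierMode ε M l b j) else 0 :=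
    fun c a b l i j => by
    simp only [fourierMode_eq, hvar]
    split_ifs
    · rw [Finset.mul_sum, ← Finset.sum_add_distrib, Finset.mul_sum]
      exact Finset.sum_congr rfl fun t _ => by ring
    · simp
  -- The products of `conj A` at row `i` with `A` at row `i'` occur with opposite signs and drop
  -- out.
  have h1 : -(ε : ℂ) * ∑ p, (conj (S.langevinVar k ε (Matrix.single i' i (-1)) M p) * A p
      + conj (A p) * S.langevinVar k ε (Matrix.single i i' 1) M p)
      = ∑ j, (S.deltaE k i i' j : ℂ) * (ε * ∑ t, conj (A (t, i, j)) * M (t, i', j)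
        + ε * ∑ t, conj (M (t, i, j)) * A (t, i', j)) := by
    rw [sum_field]
    simp only [hvar, apply_ite conj, map_zero, ite_mul, zero_mul, mul_ite, mul_zero,
      Finset.sum_add_distrib, hsum]
    rw [← Finset.sum_add_distrib]
    simp only [← Finset.sum_add_distrib]
    rw [Finset.sum_comm, Finset.mul_sum]
    refine Finset.sum_congr rfl fun j _ => ?_
    simp only [Finset.mul_sum, ← Finset.sum_add_distrib]
    refine Finset.sum_congr rfl fun t _ => ?_
    simp only [deltaE, map_mul, map_add, Complex.conj_ofReal, map_neg, map_one]
    push_cast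
    ring
  rw [exponentVar, hX, ← hA, h1]
  simp only [hF, hG, apply_ite conj, map_zero, ite_mul, zero_mul, mul_ite, mul_zero,
      Finset.sum_add_distrib, hsum]
  simp only [← sum_conj_fourierMode_mul hε, ← mul_add, ← Finset.sum_add_distrib]
  simp only [mul_left_comm _ (freqStep n ε : ℂ), ← Finset.mul_sum]
  rw [← mul_add]
  congr 1
  simp only [Finset.mul_sum]
  rw [Finset.sum_comm, ← Finset.sum_add_distrib]
  refine Finset.sum_congr rfl fun l _ => ?_
  rw [← Finset.sum_add_distrib]
  refine Finset.sum_congr rfl fun j _ => ?_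
  simp only [sourceModes, deltaE, map_mul, map_add, Complex.conj_ofReal, map_neg, map_one]
  push_cast
  ring_nf
  rw [Complex.I_sq]
  ring

theorem contDiff_partitionFunction [NeZero N] (S : MSRModel N) (hdeg : 2 ≤ S.deg)
    (ha : S.a S.deg ≠ 0) (k : ℝ) {ε : ℝ} (hε : 0 < ε) :
    ContDiff ℂ 2 (S.partitionFunction k ε : LatticeSource n N → ℂ) := by
  have h : (S.partitionFunction k ε : LatticeSource n N → ℂ) = _ :=
    funext fun J => S.partitionFunction_eq k hε J
  rw [h]
  exact (contDiff_const.mul (contDiff_contactTerm ε).cexp).mul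
    (HasExpMoments.contDiff (S.continuous_sourceCoupling_langevinField k ε).aestronglyMeasurable 2
      (S.hasExpMoments_gaussWeight hdeg ha k hε))

theorem IsFreeEnergy.contDiffOn [NeZero N] {S : MSRModel N} (hdeg : 2 ≤ S.deg)
    (ha : S.a S.deg ≠ 0) {k ε : ℝ} (hε : 0 < ε) {O : Set (LatticeSource n N)}
    {W : LatticeSource n N → ℂ} (h : S.IsFreeEnergy k ε O W) : ContDiffOn ℂ 2 W O :=
  contDiffOn_of_cexp_eq h.1 h.2.1 (S.contDiff_partitionFunction hdeg ha k hε) h.2.2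

theorem integrable_weight_outer [NeZero N] (S : MSRModel N) (hdeg : 2 ≤ S.deg)
    (ha : S.a S.deg ≠ 0) (k : ℝ) {ε : ℝ} (hε : 0 < ε) (J : LatticeSource n N) :
    Integrable fun M : LatticeField n N => ∫ χ : LatticeField n N, S.weight k ε J M χ := by
  simp_rw [S.integral_weight k hε]
  exact (S.integrable_effWeight hdeg ha k hε J).const_mul _

/-- The free energy without the contact term and the normalization of the Gaussian integral. -/
def reducedFreeEnergy (ε : ℝ) (W : LatticeSource n N → ℂ) (J : LatticeSource n N) : ℂ :=
  W J - (contactTerm ε J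
    + Complex.log ((Real.pi / ε) ^ Fintype.card (ZMod n × Fin N × Fin N) : ℝ))

theorem IsFreeEnergy.cexp_reduced {S : MSRModel N} {k ε : ℝ} (hε : 0 < ε)
    {O : Set (LatticeSource n N)} {W : LatticeSource n N → ℂ} (h : S.IsFreeEnergy k ε O W)
    (J : LatticeSource n N) (hJ : J ∈ O) : Complex.exp (reducedFreeEnergy ε W J)
      = laplaceTransform volume (fun M => sourceCoupling ε M (S.langevinField k ε M))
        (S.gaussWeight k ε) J := by
  have hc : (((Real.pi / ε) ^ Fintype.card (ZMod n × Fin N × Fin N) : ℝ) : ℂ) ≠ 0 := by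
    have := Real.pi_pos
    exact_mod_cast (by positivity : (0 : ℝ) < (Real.pi / ε) ^ _).ne'
  rw [reducedFreeEnergy, Complex.exp_sub, h.2.2 J hJ, Complex.exp_add, Complex.exp_log hc,
    S.partitionFunction_eq k hε, mul_comm (Complex.exp _),
    mul_div_cancel_left₀ _ (mul_ne_zero hc (Complex.exp_ne_zero _))]

/-! ### From mean values to derivatives of the free energy: the lattice Ward identity. -/

/-- `g` is integrable against the weight `w`, with mean value `v`, the total weight being `Z`. -/
def IsMean {Y : Type*} [MeasurableSpace Y] (μ : Measure Y) (w : Y → ℂ) (Z : ℂ) (g : Y → ℂ)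
    (v : ℂ) : Prop :=
  Integrable (fun x => w x * g x) μ ∧ ∫ x, w x * g x ∂μ = Z * v

section mean

variable {Y : Type*} [MeasurableSpace Y] {μ : Measure Y} {w : Y → ℂ} {Z : ℂ} {g g' : Y → ℂ}
  {v v' : ℂ}

theorem IsMean.add (h : IsMean μ w Z g v) (h' : IsMean μ w Z g' v') :
    IsMean μ w Z (fun x => g x + g' x) (v + v') := by
  simp only [IsMean, mul_add]
  exact ⟨h.1.add h'.1, by rw [integral_add h.1 h'.1, h.2, h'.2]⟩

theorem IsMean.const_mul (h : IsMean μ w Z g v) (c : ℂ) :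
    IsMean μ w Z (fun x => c * g x) (c * v) := by
  simp only [IsMean, mul_left_comm _ c]
  exact ⟨h.1.const_mul c, by rw [integral_const_mul, h.2]⟩

theorem IsMean.sub (h : IsMean μ w Z g v) (h' : IsMean μ w Z g' v') :
    IsMean μ w Z (fun x => g x - g' x) (v - v') := by
  simp only [IsMean, mul_sub]
  exact ⟨h.1.sub h'.1, by rw [integral_sub h.1 h'.1, h.2, h'.2]⟩

theorem IsMean.sum {ι : Type*} (s : Finset ι) {g : ι → Y → ℂ} {v : ι → ℂ}
    (h : ∀ i, IsMean μ w Z (g i) (v i)) :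
    IsMean μ w Z (fun x => ∑ i ∈ s, g i x) (∑ i ∈ s, v i) := by
  simp only [IsMean, Finset.mul_sum]
  exact ⟨integrable_finsetSum _ fun i _ => (h i).1, by
    rw [integral_finsetSum _ fun i _ => (h i).1]
    exact Finset.sum_congr rfl fun i _ => (h i).2⟩

end mean

section ward

variable [NeZero N] {S : MSRModel N} {k ε : ℝ} {O : Set (LatticeSource n N)}
  {W : LatticeSource n N → ℂ} {J : LatticeSource n N}

theorem IsFreeEnergy.contDiffOn_reduced (hdeg : 2 ≤ S.deg) (ha : S.a S.deg ≠ 0) (hε : 0 < ε)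
    (h : S.IsFreeEnergy k ε O W) : ContDiffOn ℂ 2 (reducedFreeEnergy ε W) O :=
  (h.contDiffOn hdeg ha hε).sub
    ((contDiff_contactTerm ε).add contDiff_const).contDiffOn

/-- Differentiating in one source coordinate inserts `Δω` times the conjugate mode, and the factor
`(Δω)⁻¹` in the functional derivative removes the weight `Δω`. -/
theorem IsFreeEnergy.isMean_sourceModes (hdeg : 2 ≤ S.deg) (ha : S.a S.deg ≠ 0) (hε : 0 < ε)
    (h : S.IsFreeEnergy k ε O W) (hJ : J ∈ O) (κ : SourceKind) (l : ZMod n) (i j : Fin N) :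
    IsMean volume (S.effWeight k ε J) (Complex.exp (reducedFreeEnergy ε W J))
      (fun M => sourceModes ε M (S.langevinField k ε M) (κ, l, i, j))
      (funcDeriv ε κ l i j (reducedFreeEnergy ε W) J) := by
  have hΔ : (freqStep n ε : ℂ) ≠ 0 := by exact_mod_cast (freqStep_pos (n := n) hε).ne'
  have hℓ := (S.continuous_sourceCoupling_langevinField (n := n) k ε).aestronglyMeasurable
    (μ := volume)
  have hw := S.hasExpMoments_gaussWeight (n := n) hdeg ha k hε
  have e : ∀ M : LatticeField n N, S.effWeight k ε J M
        * sourceModes ε M (S.langevinField k ε M) (κ, l, i, j)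
      = (freqStep n ε : ℂ)⁻¹ * (S.gaussWeight k ε M
        * sourceCoupling ε M (S.langevinField k ε M) (Pi.single (κ, l, i, j) 1)
        * Complex.exp (sourceCoupling ε M (S.langevinField k ε M) J)) := fun M => by
    rw [sourceCoupling_single, effWeight]
    field_simp
  simp only [IsMean, e]
  refine ⟨((hw.mul_apply hℓ _).integrable hℓ J).const_mul _, ?_⟩
  rw [integral_const_mul, funcDeriv, mul_left_comm, h.cexp_reduced hε J hJ,
    ← fderiv_eq_of_cexp_eq h.1 (h.contDiffOn_reduced hdeg ha hε) (h.cexp_reduced hε) hJ,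
    hw.fderiv_apply hℓ]
  rfl

theorem IsFreeEnergy.isMean_sourceModes_mul (hdeg : 2 ≤ S.deg) (ha : S.a S.deg ≠ 0) (hε : 0 < ε)
    (h : S.IsFreeEnergy k ε O W) (hJ : J ∈ O) (κ κ' : SourceKind) (l l' : ZMod n)
    (i j i' j' : Fin N) :
    IsMean volume (S.effWeight k ε J) (Complex.exp (reducedFreeEnergy ε W J))
      (fun M => sourceModes ε M (S.langevinField k ε M) (κ, l, i, j)
        * sourceModes ε M (S.langevinField k ε M) (κ', l', i', j'))
      (funcDeriv ε κ l i j (funcDeriv ε κ' l' i' j' (reducedFreeEnergy ε W)) J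
        + funcDeriv ε κ l i j (reducedFreeEnergy ε W) J
          * funcDeriv ε κ' l' i' j' (reducedFreeEnergy ε W) J) := by
  have hΔ : (freqStep n ε : ℂ) ≠ 0 := by exact_mod_cast (freqStep_pos (n := n) hε).ne'
  have hℓ := (S.continuous_sourceCoupling_langevinField (n := n) k ε).aestronglyMeasurable
    (μ := volume)
  have hw := S.hasExpMoments_gaussWeight (n := n) hdeg ha k hε
  have hw' := hw.mul_apply hℓ (Pi.single (κ', l', i', j') 1)
  have e : ∀ M : LatticeField n N, S.effWeight k ε J M
        * (sourceModes ε M (S.langevinField k ε M) (κ, l, i, j)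
          * sourceModes ε M (S.langevinField k ε M) (κ', l', i', j'))
      = (freqStep n ε : ℂ)⁻¹ ^ 2 * (S.gaussWeight k ε M
        * sourceCoupling ε M (S.langevinField k ε M) (Pi.single (κ', l', i', j') 1)
        * sourceCoupling ε M (S.langevinField k ε M) (Pi.single (κ, l, i, j) 1)
        * Complex.exp (sourceCoupling ε M (S.langevinField k ε M) J)) := fun M => by
    rw [sourceCoupling_single, sourceCoupling_single, effWeight]
    field_simp
  simp only [IsMean, e]
  refine ⟨((hw'.mul_apply hℓ _).integrable hℓ J).const_mul _, ?_⟩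
  have hC := h.contDiffOn_reduced hdeg ha hε
  have h2 := fderiv_fderiv_eq_of_cexp_eq h.1 hC (h.cexp_reduced hε) hJ
    (Pi.single (κ, l, i, j) 1) (Pi.single (κ', l', i', j') 1)
  simp only [hw.fderiv_apply hℓ] at h2
  rw [hw'.fderiv_apply hℓ, ← h.cexp_reduced hε J hJ] at h2
  have hd2 : DifferentiableAt ℂ (fun J => fderiv ℂ (reducedFreeEnergy ε W) J
      (Pi.single (κ', l', i', j') 1)) J := by
    have := ((hC.contDiffAt (h.1.mem_nhds hJ)).fderiv_right (m := 1)
      (by norm_num)).differentiableAt (by norm_num)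
    exact this.clm_apply (differentiableAt_const _)
  have h3 : fderiv ℂ (funcDeriv ε κ' l' i' j' (reducedFreeEnergy ε W)) J
        (Pi.single (κ, l, i, j) 1)
      = (freqStep n ε : ℂ)⁻¹ * fderiv ℂ (fun J => fderiv ℂ (reducedFreeEnergy ε W) J
      (Pi.single (κ', l', i', j') 1)) J (Pi.single (κ, l, i, j) 1) := by
    have := (hd2.hasFDerivAt.const_mul (freqStep n ε : ℂ)⁻¹).fderiv
    unfold funcDeriv
    rw [this]
    rfl
  rw [integral_const_mul]
  change _ * laplaceTransform _ _ _ J = _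
  rw [h2]
  simp only [funcDeriv] at h3 ⊢
  rw [h3]
  ring

/-- The contact term is the bilinear pairing of `L̃` with `conj L̃`, so it shifts `η̄` and `η` by
the opposite source and leaves `Φ`, `Φ̄` alone. -/
theorem IsFreeEnergy.funcDeriv_eq (hdeg : 2 ≤ S.deg) (ha : S.a S.deg ≠ 0) (hε : 0 < ε)
    (h : S.IsFreeEnergy k ε O W) (hJ : J ∈ O) (κ : SourceKind) (l : ZMod n) (i j : Fin N) :
    funcDeriv ε κ l i j W J = funcDeriv ε κ l i j (reducedFreeEnergy ε W) J
      + (match κ with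
        | .L => 0
        | .Lbar => 0
        | .Lt => J (.Ltbar, l, i, j)
        | .Ltbar => J (.Lt, l, i, j)) := by
  have hΔ : (freqStep n ε : ℂ) ≠ 0 := by exact_mod_cast (freqStep_pos (n := n) hε).ne'
  have hd : DifferentiableAt ℂ W J :=
    ((h.contDiffOn hdeg ha hε).contDiffAt (h.1.mem_nhds hJ)).differentiableAt (by norm_num)
  have hr := hd.hasFDerivAt.sub ((hasFDerivAt_contactTerm ε J).differentiableAt.hasFDerivAt.add_const
    (Complex.log ((Real.pi / ε) ^ Fintype.card (ZMod n × Fin N × Fin N) : ℝ)))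
  have e : fderiv ℂ (reducedFreeEnergy ε W) J = fderiv ℂ W J - fderiv ℂ (contactTerm ε) J :=
    hr.fderiv
  rw [funcDeriv, funcDeriv, e, sub_apply, fderiv_contactTerm_single, mul_sub,
    inv_mul_cancel_left₀ hΔ]
  ring

/-- The inner derivative is in `L` or `L̄`, which are absent from the contact term, so the two first
derivatives agree on a whole neighbourhood of `J`. -/
theorem IsFreeEnergy.funcDeriv_funcDeriv_eq (hdeg : 2 ≤ S.deg) (ha : S.a S.deg ≠ 0) (hε : 0 < ε)
    (h : S.IsFreeEnergy k ε O W) (hJ : J ∈ O) {κ' : SourceKind} (hκ : κ' = .L ∨ κ' = .Lbar)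
    (κ : SourceKind) (l l' : ZMod n) (i j i' j' : Fin N) :
    funcDeriv ε κ l i j (funcDeriv ε κ' l' i' j' W) J
      = funcDeriv ε κ l i j (funcDeriv ε κ' l' i' j' (reducedFreeEnergy ε W)) J := by
  have e : funcDeriv ε κ' l' i' j' W =ᶠ[𝓝 J]
      funcDeriv ε κ' l' i' j' (reducedFreeEnergy ε W) := by
    filter_upwards [h.1.mem_nhds hJ] with J' hJ'
    rw [h.funcDeriv_eq hdeg ha hε hJ']
    rcases hκ with rfl | rfl <;> simp
  rw [funcDeriv, e.fderiv_eq]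
  rfl

/-- The Ward identity on the time lattice. -/
theorem IsFreeEnergy.ward (hdeg : 2 ≤ S.deg) (ha : S.a S.deg ≠ 0) (hε : 0 < ε)
    (h : S.IsFreeEnergy k ε O W) (hJ : J ∈ O) (i i' : Fin N) :
    (freqStep n ε : ℂ) * ∑ l : ZMod n, ∑ j : Fin N,
      (Complex.I * (S.deltaE k i i' j : ℂ) *
          (corrEtaBarPhi ε W J l i' j l i j + fieldEtaBar ε W J l i j * fieldPhi ε W J l i' j
            + corrPhiBarEta ε W J l i j l i' j
            + fieldEta ε W J l i' j * fieldPhiBar ε W J l i j)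
        + (J (.Lbar, l, i, j) * fieldPhi ε W J l i' j
          - J (.L, l, i', j) * fieldPhiBar ε W J l i j
          + J (.Ltbar, l, i, j) * fieldEta ε W J l i' j
          - J (.Lt, l, i', j) * fieldEtaBar ε W J l i j)) = 0 := by
  have m1 := fun κ l i j => h.isMean_sourceModes hdeg ha hε hJ κ l i j
  have m2 := fun κ κ' l i j i' j' => h.isMean_sourceModes_mul hdeg ha hε hJ κ κ' l l i j i' j'
  have key := IsMean.const_mul (IsMean.sum Finset.univ fun l => IsMean.sum Finset.univ fun j =>
    (((((m2 .Lt .Lbar l i j i' j).add ((m1 .Lbar l i' j).const_mul (J (.Ltbar, l, i, j)))).add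
      (m2 .Ltbar .L l i' j i j)).add ((m1 .L l i j).const_mul (J (.Lt, l, i', j)))).const_mul
        (Complex.I * (S.deltaE k i i' j : ℂ))).add
    (((((m1 .Lbar l i' j).const_mul (J (.Lbar, l, i, j))).sub
      ((m1 .L l i j).const_mul (J (.L, l, i', j)))).add
      ((m1 .Ltbar l i' j).const_mul (J (.Ltbar, l, i, j)))).sub
      ((m1 .Lt l i j).const_mul (J (.Lt, l, i', j))))) (freqStep n ε : ℂ)
  have h0 := key.2
  simp only [← S.exponentVar_single k hε J i i'] at h0
  rw [S.integral_exponentVar hdeg ha k hε J] at h0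
  -- The integral is the total weight times the wanted expression, and the total weight is an
  -- exponential, hence nonzero.
  have h1 := (mul_eq_zero.1 h0.symm).resolve_left (Complex.exp_ne_zero _)
  rw [← h1]
  congr 1
  refine Finset.sum_congr rfl fun l _ => Finset.sum_congr rfl fun j _ => ?_
  simp only [corrEtaBarPhi, corrPhiBarEta, fieldPhi, fieldPhiBar, fieldEta, fieldEtaBar]
  rw [h.funcDeriv_funcDeriv_eq hdeg ha hε hJ (Or.inr rfl),
    h.funcDeriv_funcDeriv_eq hdeg ha hε hJ (Or.inl rfl)]
  simp only [h.funcDeriv_eq hdeg ha hε hJ]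
  ring

end ward

end MSRModel

/-! ### Lattice functions as step functions of frequency. -/

section stepFn

variable {n : ℕ}

theorem stepFn_eq_of_binary (op : ℂ → ℂ → ℂ) (h0 : op 0 0 = 0) (ε : ℝ) (f g : ZMod n → ℂ) (ω : ℝ) :
    stepFn ε (fun l => op (f l) (g l)) ω = op (stepFn ε f ω) (stepFn ε g ω) := by
  unfold stepFn
  split_ifs
  · rfl
  · exact h0.symm

theorem measurable_stepFn (ε : ℝ) (f : ZMod n → ℂ) : Measurable (stepFn ε f) := by
  have h1 : Measurable fun ω : ℝ => round (ω / freqStep n ε) := by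
    simp only [round_eq]
    fun_prop
  have h2 : Measurable fun m : ℤ => if ((m : ZMod n)).valMinAbs = m then f (m : ZMod n) else 0 :=
    measurable_of_countable _
  exact h2.comp h1

variable [NeZero n]

/-- Rounding to the integer `m` selects the half-open cell around `m Δω`, and the band consists of
the integers that are their own minimal representatives. -/
theorem stepFn_eq_sum {ε : ℝ} (hε : 0 < ε) (f : ZMod n → ℂ) :
    stepFn ε f = fun ω => ∑ l : ZMod n, (Set.Ico (freqStep n ε * (l.valMinAbs - 1 / 2))
      (freqStep n ε * (l.valMinAbs + 1 / 2))).indicator (fun _ => f l) ω := by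
  have hΔ := freqStep_pos (n := n) hε
  funext ω
  have hmem : ∀ l : ZMod n, ω ∈ Set.Ico (freqStep n ε * (l.valMinAbs - 1 / 2))
      (freqStep n ε * (l.valMinAbs + 1 / 2)) ↔ round (ω / freqStep n ε) = l.valMinAbs := fun l => by
    rw [round_eq_iff, Set.mem_Ico, Set.mem_Ico, le_div_iff₀' hΔ, div_lt_iff₀' hΔ]
  simp only [Set.indicator_apply, hmem, stepFn]
  generalize round (ω / freqStep n ε) = m
  split_ifs with h
  · rw [Finset.sum_eq_single (m : ZMod n)]
    · rw [if_pos h.symm]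
    · intro l _ hl
      rw [if_neg]
      rintro rfl
      exact hl (ZMod.coe_valMinAbs l).symm
    · simp
  · symm
    refine Finset.sum_eq_zero fun l _ => if_neg ?_
    rintro rfl
    exact h (by rw [ZMod.coe_valMinAbs])

theorem integrable_stepFn {ε : ℝ} (hε : 0 < ε) (f : ZMod n → ℂ) : Integrable (stepFn ε f) := by
  rw [stepFn_eq_sum hε]
  exact integrable_finsetSum _ fun l _ =>
    (integrable_indicator_iff measurableSet_Ico).2 (integrableOn_const (by simp))

theorem integral_stepFn {ε : ℝ} (hε : 0 < ε) (f : ZMod n → ℂ) :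
    ∫ ω, stepFn ε f ω = freqStep n ε * ∑ l, f l := by
  have hΔ := freqStep_pos (n := n) hε
  rw [stepFn_eq_sum hε, integral_finsetSum _ fun l _ =>
    (integrable_indicator_iff measurableSet_Ico).2 (integrableOn_const (by simp)), Finset.mul_sum]
  refine Finset.sum_congr rfl fun l _ => ?_
  rw [integral_indicator measurableSet_Ico, setIntegral_const, Complex.real_smul, Measure.real,
    Real.volume_Ico]
  congr 2
  rw [ENNReal.toReal_ofReal (by nlinarith)]
  ring

end stepFn

/-! ### Convergence of lattice functions to functions on the frequency line. -/

section freqTendsto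

variable {r : ENNReal} {n : ℕ → ℕ} {ε : ℕ → ℝ} {f f' : ∀ s, ZMod (n s) → ℂ} {g g' : ℝ → ℂ}

theorem FreqTendsto.add (hr : 1 ≤ r) (h : FreqTendsto r n ε f g) (h' : FreqTendsto r n ε f' g') :
    FreqTendsto r n ε (fun s l => f s l + f' s l) (fun ω => g ω + g' ω) := by
  refine ⟨h.1.add h'.1, ?_⟩
  have ht := h.2.add h'.2
  rw [add_zero] at ht
  refine tendsto_of_tendsto_of_tendsto_of_le_of_le tendsto_const_nhds ht (fun _ => zero_le)
    fun s => ?_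
  refine le_trans (le_of_eq ?_) (eLpNorm_add_le
    ((measurable_stepFn (ε s) (f s)).aestronglyMeasurable.sub h.1.1)
    ((measurable_stepFn (ε s) (f' s)).aestronglyMeasurable.sub h'.1.1) hr)
  congr 1
  funext ω
  simp only [Pi.add_apply, stepFn_eq_of_binary (· + ·) (add_zero 0)]
  ring

theorem FreqTendsto.const_mul (c : ℂ) (h : FreqTendsto r n ε f g) :
    FreqTendsto r n ε (fun s l => c * f s l) (fun ω => c * g ω) := by
  refine ⟨h.1.const_mul c, ?_⟩
  have e : ∀ s, eLpNorm (fun ω => stepFn (ε s) (fun l => c * f s l) ω - c * g ω) r volume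
      = ‖c‖ₑ * eLpNorm (fun ω => stepFn (ε s) (f s) ω - g ω) r volume := fun s => by
    rw [← eLpNorm_const_smul]
    congr 1
    funext ω
    have := stepFn_eq_of_binary (fun x _ => c * x) (mul_zero c) (ε s) (f s) (f s) ω
    simp only [Pi.smul_apply, smul_eq_mul] at this ⊢
    rw [this]; ring
  simp only [e]
  have := ENNReal.Tendsto.const_mul (a := ‖c‖ₑ) h.2 (Or.inr enorm_ne_top)
  rwa [mul_zero] at this

theorem FreqTendsto.zero : FreqTendsto r n ε (fun _ _ => 0) (fun _ => 0) := by
  refine ⟨MemLp.zero', ?_⟩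
  have : ∀ s, stepFn (ε s) (fun _ : ZMod (n s) => (0 : ℂ)) = fun _ => 0 := fun s => by
    funext ω; simp [stepFn]
  simp only [this, sub_self]
  simp

theorem FreqTendsto.sub (hr : 1 ≤ r) (h : FreqTendsto r n ε f g) (h' : FreqTendsto r n ε f' g') :
    FreqTendsto r n ε (fun s l => f s l - f' s l) (fun ω => g ω - g' ω) := by
  have := h.add hr (h'.const_mul (-1))
  simpa only [neg_mul, one_mul, ← sub_eq_add_neg] using this

theorem FreqTendsto.sum (hr : 1 ≤ r) {ι : Type*} (t : Finset ι) {f : ι → ∀ s, ZMod (n s) → ℂ}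
    {g : ι → ℝ → ℂ} (h : ∀ i, FreqTendsto r n ε (f i) (g i)) :
    FreqTendsto r n ε (fun s l => ∑ i ∈ t, f i s l) (fun ω => ∑ i ∈ t, g i ω) := by
  classical
  induction t using Finset.induction_on with
  | empty => simpa using FreqTendsto.zero
  | insert a t ha ih =>
    simp only [Finset.sum_insert ha]
    exact (h a).add hr ih

/-- With errors `u`, `v`, the product differs from its limit by `uv + u g' + g v`, and the
Cauchy–Schwarz inequality bounds each piece in `L¹`. -/
theorem FreqTendsto.mul (h : FreqTendsto 2 n ε f g) (h' : FreqTendsto 2 n ε f' g') :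
    FreqTendsto 1 n ε (fun s l => f s l * f' s l) (fun ω => g ω * g' ω) := by
  refine ⟨h'.1.mul h.1, ?_⟩
  set a := fun s => eLpNorm (fun ω => stepFn (ε s) (f s) ω - g ω) 2 volume with ha
  set b := fun s => eLpNorm (fun ω => stepFn (ε s) (f' s) ω - g' ω) 2 volume with hb
  have ht : Tendsto (fun s => a s * b s + (a s * eLpNorm g' 2 volume + eLpNorm g 2 volume * b s))
      atTop (𝓝 0) := by
    have h1 := ENNReal.Tendsto.mul h.2 (Or.inr ENNReal.zero_ne_top) h'.2 (Or.inr ENNReal.zero_ne_top)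
    have h2 := ENNReal.Tendsto.mul_const (b := eLpNorm g' 2 volume) h.2 (Or.inr h'.1.2.ne)
    have h3 := ENNReal.Tendsto.const_mul (a := eLpNorm g 2 volume) h'.2 (Or.inr h.1.2.ne)
    have := h1.add (h2.add h3)
    simpa using this
  refine tendsto_of_tendsto_of_tendsto_of_le_of_le tendsto_const_nhds ht (fun _ => zero_le)
    fun s => ?_
  have m1 := (measurable_stepFn (ε s) (f s)).aestronglyMeasurable.sub h.1.1
  have m2 := (measurable_stepFn (ε s) (f' s)).aestronglyMeasurable.sub h'.1.1
  have e : (fun ω => stepFn (ε s) (fun l => f s l * f' s l) ω - g ω * g' ω)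
      = (stepFn (ε s) (f s) - g) • (stepFn (ε s) (f' s) - g')
        + ((stepFn (ε s) (f s) - g) • g' + g • (stepFn (ε s) (f' s) - g')) := by
    funext ω
    simp only [smul_eq_mul, Pi.add_apply, Pi.mul_apply, Pi.sub_apply,
      stepFn_eq_of_binary (· * ·) (mul_zero 0)]
    ring
  rw [e]
  refine (eLpNorm_add_le (m1.smul m2) ((m1.smul h'.1.1).add (h.1.1.smul m2)) le_rfl).trans ?_
  refine add_le_add (eLpNorm_smul_le_mul_eLpNorm m2 m1) ?_
  refine (eLpNorm_add_le (m1.smul h'.1.1) (h.1.1.smul m2) le_rfl).trans ?_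
  exact add_le_add (eLpNorm_smul_le_mul_eLpNorm h'.1.1 m1) (eLpNorm_smul_le_mul_eLpNorm m2 h.1.1)

theorem FreqTendsto.tendsto_sum [∀ s, NeZero (n s)] (hε : ∀ s, 0 < ε s)
    (h : FreqTendsto 1 n ε f g) :
    Tendsto (fun s => (freqStep (n s) (ε s) : ℂ) * ∑ l, f s l) atTop (𝓝 (∫ ω, g ω)) := by
  simp only [← integral_stepFn (hε _)]
  exact tendsto_integral_of_L1' g h.1.1
    (Eventually.of_forall fun s => integrable_stepFn (hε s) (f s)) h.2

end freqTendsto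

/-! ### Passage to the continuum. -/

namespace MSRModel

variable {N : ℕ}

theorem freqTendsto_ward (S : MSRModel N) (k : ℝ) {n : ℕ → ℕ} [∀ s, NeZero (n s)] {ε : ℕ → ℝ}
    {W : ∀ s, LatticeSource (n s) N → ℂ} {J : ∀ s, LatticeSource (n s) N} {D : ContinuumData N}
    (h : IsContinuumLimit n ε W J D) (i i' : Fin N) :
    FreqTendsto 1 n ε (fun s l => ∑ j : Fin N,
      (Complex.I * (S.deltaE k i i' j : ℂ) *
          (corrEtaBarPhi (ε s) (W s) (J s) l i' j l i j
            + fieldEtaBar (ε s) (W s) (J s) l i j * fieldPhi (ε s) (W s) (J s) l i' j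
            + corrPhiBarEta (ε s) (W s) (J s) l i j l i' j
            + fieldEta (ε s) (W s) (J s) l i' j * fieldPhiBar (ε s) (W s) (J s) l i j)
        + (J s (.Lbar, l, i, j) * fieldPhi (ε s) (W s) (J s) l i' j
          - J s (.L, l, i', j) * fieldPhiBar (ε s) (W s) (J s) l i j
          + J s (.Ltbar, l, i, j) * fieldEta (ε s) (W s) (J s) l i' j
          - J s (.Lt, l, i', j) * fieldEtaBar (ε s) (W s) (J s) l i j)))
      (fun ω => ∑ j : Fin N,
        (Complex.I * (S.deltaE k i i' j : ℂ) *
            (D.GEtaBarPhi i' i j ω + D.EtaBar i j ω * D.Phi i' j ω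
              + D.GPhiBarEta i i' j ω + D.Eta i' j ω * D.PhiBar i j ω)
          + (D.Lbar i j ω * D.Phi i' j ω - D.L i' j ω * D.PhiBar i j ω
            + D.Ltbar i j ω * D.Eta i' j ω - D.Lt i' j ω * D.EtaBar i j ω))) := by
  refine FreqTendsto.sum le_rfl Finset.univ fun j => FreqTendsto.add le_rfl ?_
    (FreqTendsto.sub le_rfl (FreqTendsto.add le_rfl (FreqTendsto.sub le_rfl
      ((h.Lbar i j).mul (h.Phi i' j)) ((h.L i' j).mul (h.PhiBar i j)))
      ((h.Ltbar i j).mul (h.Eta i' j))) ((h.Lt i' j).mul (h.EtaBar i j)))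
  -- For equal labels no convergence of `G` is assumed, but `δE = 0` removes these terms on both
  -- sides.
  by_cases hi : i = i'
  · subst hi
    simpa [deltaE] using FreqTendsto.zero
  · exact FreqTendsto.const_mul _ (FreqTendsto.add le_rfl (FreqTendsto.add le_rfl
      (FreqTendsto.add le_rfl (h.GEtaBarPhi i i' j hi) ((h.EtaBar i j).mul (h.Phi i' j)))
      (h.GPhiBarEta i i' j hi)) ((h.Eta i' j).mul (h.PhiBar i j)))

end MSRModel
end
theorem mainTheorem2 {N : ℕ} (S : MSRModel N) (hdeg : 2 ≤ S.deg) (ha : S.a S.deg ≠ 0) (k : ℝ)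
    (i i' : Fin N) :
    (∀ (n : ℕ) [NeZero n] (ε : ℝ), 0 < ε →
      (∀ J : LatticeSource n N,
        (∀ M : LatticeField n N, Integrable fun χ : LatticeField n N => S.weight k ε J M χ) ∧
        Integrable fun M : LatticeField n N => ∫ χ : LatticeField n N, S.weight k ε J M χ) ∧
      S.partitionFunction k ε (0 : LatticeSource n N) ≠ 0 ∧
      ∀ (O : Set (LatticeSource n N)) (W : LatticeSource n N → ℂ), S.IsFreeEnergy k ε O W →
        ContDiffOn ℂ 2 W O ∧
        ∀ J ∈ O,
          (freqStep n ε : ℂ) * ∑ l : ZMod n, ∑ j : Fin N,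
            (Complex.I * (S.deltaE k i i' j : ℂ) *
                (corrEtaBarPhi ε W J l i' j l i j + fieldEtaBar ε W J l i j * fieldPhi ε W J l i' j
                  + corrPhiBarEta ε W J l i j l i' j
                  + fieldEta ε W J l i' j * fieldPhiBar ε W J l i j)
              + (J (.Lbar, l, i, j) * fieldPhi ε W J l i' j
                - J (.L, l, i', j) * fieldPhiBar ε W J l i j
                + J (.Ltbar, l, i, j) * fieldEta ε W J l i' j
                - J (.Lt, l, i', j) * fieldEtaBar ε W J l i j)) = 0) ∧
    (∀ (n : ℕ → ℕ) [∀ s, NeZero (n s)] (ε : ℕ → ℝ), (∀ s, 0 < ε s) →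
      ∀ (O : ∀ s, Set (LatticeSource (n s) N)) (W : ∀ s, LatticeSource (n s) N → ℂ)
        (J : ∀ s, LatticeSource (n s) N) (D : ContinuumData N),
        (∀ s, S.IsFreeEnergy k (ε s) (O s) (W s)) → (∀ s, J s ∈ O s) →
        IsContinuumLimit n ε W J D →
        (Integrable fun ω : ℝ => ∑ j : Fin N,
            (Complex.I * (S.deltaE k i i' j : ℂ) *
                (D.GEtaBarPhi i' i j ω + D.EtaBar i j ω * D.Phi i' j ω
                  + D.GPhiBarEta i i' j ω + D.Eta i' j ω * D.PhiBar i j ω)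
              + (D.Lbar i j ω * D.Phi i' j ω - D.L i' j ω * D.PhiBar i j ω
                + D.Ltbar i j ω * D.Eta i' j ω - D.Lt i' j ω * D.EtaBar i j ω))) ∧
        ∫ ω : ℝ, ∑ j : Fin N,
            (Complex.I * (S.deltaE k i i' j : ℂ) *
                (D.GEtaBarPhi i' i j ω + D.EtaBar i j ω * D.Phi i' j ω
                  + D.GPhiBarEta i i' j ω + D.Eta i' j ω * D.PhiBar i j ω)
              + (D.Lbar i j ω * D.Phi i' j ω - D.L i' j ω * D.PhiBar i j ω
                + D.Ltbar i j ω * D.Eta i' j ω - D.Lt i' j ω * D.EtaBar i j ω)) = 0) := by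
  -- The index `i` itself witnesses `N ≥ 1`.
  have : NeZero N := ⟨fun h => by subst h; exact i.elim0⟩
  refine ⟨fun n _ ε hε => ⟨fun J => ⟨S.integrable_weight k hε J,
    S.integrable_weight_outer hdeg ha k hε J⟩, S.partitionFunction_zero_ne_zero hdeg ha k hε,
    fun O W h => ⟨h.contDiffOn hdeg ha hε, fun J hJ => h.ward hdeg ha hε hJ i i'⟩⟩,
    fun n _ ε hε O W J D h hJ hD => ?_⟩
  have hT := S.freqTendsto_ward k hD i i'
  refine ⟨memLp_one_iff_integrable.1 hT.1, ?_⟩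
  -- The lattice sums converge to the continuum integral, and each of them vanishes by the lattice
  -- identity.
  refine tendsto_nhds_unique (hT.tendsto_sum hε) ?_
  simp only [(h _).ward hdeg ha (hε _) (hJ _) i i']
  exact tendsto_const_nhds
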